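/- **Setting.** Let $V$ be a finite set of variables; variable $\gamma\in V$ has a finite set of levels $\mathcal I_\gamma$ with a distinguished level $0$. For $A\subseteq V$ let $\mathcal I_A=\prod_{\gamma\in A}\mathcal I_\gamma$ (the cells of the $A$-table; $i^*$ denotes the cell with all levels $0$) and $\mathcal I_A^*=\{i_A\in\mathcal I_A: i_\gamma\neq 0\ \forall\gamma\in A\}$. Let $G$ be an undirected graph on $V$ and $\mathcal D^A$ the set of nonempty $D\subseteq A$ that are complete in $G$. For a parameter $\theta=(\theta_D(i_D))_{D\in\mathcal D^A,\,i_D\in\mathcal I_D^*}$ put, for $j\in\mathcal I_A$, $$Z_A(\theta)=1+\sum_{j\in\mathcal I_A,\ j\ne i^*}\exp\sum_{D\in\mathcal D^A:\ j_\gamma\ne0\,\forall\gamma\in D}\theta_D(j_D),\qquad p_\theta(j)=\frac1{Z_A(\theta)}\exp\sum_{D\in\mathcal D^A:\ j_\gamma\ne0\,\forall\gamma\in D}\theta_D(j_D).$$ The conjugate prior on $A$ with hyperparameters $s=(s(i_D))_{D\in\mathcal D^A,\,i_D\in\mathcal I_D^*}$ real and $\alpha\in\mathbb R$ has the density, with respect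 to Lebesgue measure $d\theta$, $$\pi_A(\theta|s,\alpha)=I_A(s,\alpha)^{-1}\exp\Big\{\sum_{D\in\mathcal D^A}\sum_{i_D\in\mathcal I_D^*}\theta_D(i_D)s(i_D)-\alpha\log Z_A(\theta)\Big\},$$ where $I_A(s,\alpha)$ is the integral of the exponential; it is proper if $I_A(s,\alpha)<\infty$. Write $\pi_G=\pi_V$. For a parameter $\theta$ of the full table ($A=V$) and $B\subseteq V$, let $p^B$ be the $B$-marginal of $p_\theta$ and $\theta^B$ its log-linear parameter, $\theta^B_D(i_D)=\sum_{F\subseteq D}(-1)^{|D\setminus F|}\log p^B(i_F,i^*_{B\setminus F})$ for $D\in\mathcal D^B$, $i_D\in\mathcal I_D^*$; let $s^B$ be the restriction of $s$ to $\mathcal D^B$. Let $f_A(\cdot|s,\alpha)$ denote the Lebesgue density, when it exists, of the prior induced by $\pi_A(\cdot|s,\alpha)$ on the cell probabilities, taken in the coordinates $m=(p(i_D))_{D\in\mathcal D^A,\,i_D\in\mathcal I_D^*}$, where $p(i_D)=\sum_{j\in\mathcal I_A,\,j_D=i_D}p_\theta(j)$; that is, $f_A(\cdot|s,\alpha)$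 is the density of the law of $m$ when $\theta\sim\pi_A(\cdot|s,\alpha)$. A set $W\subseteq V$ is prime if it is not a disjoint union $W=A\cup B\cup C$ with $A,B\neq\emptyset$, $C$ complete, and $C$ separating $A$ from $B$ in the subgraph induced by $W$; the prime components of $G$ are the maximal prime sets. Let $P_1,\dots,P_k$ be a perfect enumeration of the prime components: each component is listed exactly once and, for $2\le l\le k$, the separator $S_l=P_l\cap(P_1\cup\dots\cup P_{l-1})$ is complete and contained in some $P_q$ with $q<l$. **Proposition 5.1.** Suppose that $\pi_G(\cdot|s,\alpha)$ is proper. Then the conjugate priors $\pi_{P_l}(\cdot|s^{P_l},\alpha)$, $1\le l\le k$, and $\pi_{S_l}(\cdot|s^{S_l},\alpha)$, $2\le l\le k$, are proper and, for every $\theta$, $$\pi_G(\theta|s,\alpha)=\frac{\prod_{l=1}^k\pi_{P_l}(\theta^{P_l}|s^{P_l},\alpha)}{\prod_{l=2}^k\pi_{S_l}(\theta^{S_l}|s^{S_l},\alpha)}.$$ Moreover the priors induced on the cell probabilities by $\pi_G(\cdot|s,\alpha)$, by the $\pi_{P_l}(\cdot|s^{P_l},\alpha)$ and by the $\pi_{S_l}(\cdot|s^{S_l},\alpha)$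 all have Lebesgue densities (in the coordinates above), and, for Lebesgue-almost every $m=(m(i_D))_{D\in\mathcal D^V,\,i_D\in\mathcal I_D^*}$ in the whole coordinate space, $$f_V(m|s,\alpha)=\frac{\prod_{l=1}^k f_{P_l}(m^{P_l}|s^{P_l},\alpha)}{\prod_{l=2}^k f_{S_l}(m^{S_l}|s^{S_l},\alpha)},$$ where $m^B$ is the restriction of $m$ to $\mathcal D^B$ (with the convention $0/0=0$). -/

import Mathlib

open MeasureTheory

noncomputable section

namespace ContingencyTable

/-! ### Graphs: prime components and their perfect enumerations -/

section Graph

variable {V : Type*} [DecidableEq V]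

/-- `(A, B, C)` is a proper decomposition of the subgraph of `G` induced by `W`: the sets partition
`W`, `A` and `B` are nonempty, `C` is complete and separates `A` from `B`. (Since `A`, `B`, `C`
exhaust `W`, separation in the induced subgraph means that no edge joins `A` to `B`.) -/
structure IsProperDecomposition (G : SimpleGraph V) (W A B C : Finset V) : Prop where
  union_eq : A ∪ B ∪ C = W
  disjoint_AB : Disjoint A B
  disjoint_AC : Disjoint A C
  disjoint_BC : Disjoint B C
  nonempty_left : A.Nonempty
  nonempty_right : B.Nonempty
  complete : G.IsClique (C : Set V)
  separates : ∀ a ∈ A, ∀ b ∈ B, ¬ G.Adj a b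

/-- The subgraph induced by `W` is prime: it has no proper decomposition. -/
def IsPrimeSet (G : SimpleGraph V) (W : Finset V) : Prop :=
  ¬ ∃ A B C : Finset V, IsProperDecomposition G W A B C

/-- The (vertex sets of) prime components of `G`: the maximal prime induced subgraphs. -/
def IsPrimeComponent (G : SimpleGraph V) (W : Finset V) : Prop :=
  Maximal (IsPrimeSet G) W

/-- `S_l = P_l ∩ (P_1 ∪ ⋯ ∪ P_{l-1})`. -/
def separator {n : ℕ} (P : Fin n → Finset V) (l : Fin n) : Finset V :=
  P l ∩ (Finset.univ.filter (fun j => j < l)).biUnion P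

/-- `P` lists every prime component of `G` exactly once, in a perfect order: each separator (from
the second one on) is complete and contained in an earlier component. -/
structure IsPerfectEnumeration (G : SimpleGraph V) {k : ℕ} (P : Fin (k + 1) → Finset V) :
    Prop where
  injective : Function.Injective P
  mem_iff : ∀ W : Finset V, IsPrimeComponent G W ↔ ∃ l, P l = W
  running_intersection : ∀ l, l ≠ 0 → ∃ q, q < l ∧ separator P l ⊆ P q
  complete : ∀ l, l ≠ 0 → G.IsClique (separator P l : Set V)

end Graph

/-! ### The log-linear model

`I v` is the set of levels of the variable `v`, and `0 : I v` its lowest level. Everything is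
defined for the marginal table of a set `A` of variables; the full table is `A = Finset.univ`. -/

section Model

variable {V : Type*} {I : V → Type*}

/-- The cells `i_A` of the `A`-marginal table. The reference cell `i^*` is `0`. -/
abbrev Cell (I : V → Type*) (A : Finset V) : Type _ := ∀ v : A, I v

variable [∀ v, Zero (I v)]

/-- The indices `(D, i_D)` of the free parameters on `A`: `D` is a nonempty complete subset of `A`
and `i_D` is a cell of the `D`-marginal table all of whose levels are nonzero. -/
@[ext] structure Param (I : V → Type*) [∀ v, Zero (I v)] (G : SimpleGraph V) (A : Finset V) where
  D : Finset V
  nonempty : D.Nonempty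
  subset : D ⊆ A
  complete : G.IsClique (D : Set V)
  level : Cell I D
  level_ne : ∀ v, level v ≠ 0

variable {G : SimpleGraph V}

instance [∀ v, Finite (I v)] [Finite V] (A : Finset V) : Finite (Param I G A) := by
  have h : Function.Injective
      (fun x : Param I G A => (⟨x.D, x.level⟩ : Σ D : Finset V, Cell I D)) := by
    intro x y hxy
    simp only [Sigma.mk.injEq] at hxy
    exact Param.ext hxy.1 hxy.2
  exact Finite.of_injective _ h

instance [Fintype V] [∀ v, Fintype (I v)] (A : Finset V) : Fintype (Param I G A) :=
  Fintype.ofFinite _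

namespace Param

variable {A B : Finset V}

/-- An index `(D, i_D)` on `B`, seen as an index on `A ⊇ B`. -/
def incl (h : B ⊆ A) (x : Param I G B) : Param I G A :=
  { x with subset := x.subset.trans h }

/-- `j_D = i_D`, for a cell `j` and an index `(D, i_D)`. -/
def Matches (x : Param I G A) (j : Cell I A) : Prop :=
  ∀ v : x.D, j ⟨v, x.subset v.2⟩ = x.level v

open scoped Classical in
/-- The cell `(i_F, i^*_{F^c})` of the `A`-marginal table, for an index `(D, i_D)` and `F ⊆ D`. -/
def cell (x : Param I G A) (F : Finset V) : Cell I A := fun v =>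
  if v.1 ∈ F then (if h : v.1 ∈ x.D then x.level ⟨v.1, h⟩ else 0) else 0

end Param

/-- Restriction of a family indexed by the `(D, i_D)` on `A` to the indices on `B ⊆ A`. -/
def restrictTo {A B : Finset V} (h : B ⊆ A) (s : Param I G A → ℝ) : Param I G B → ℝ :=
  fun x => s (x.incl h)

variable [Fintype V] [DecidableEq V] [∀ v, Fintype (I v)] {A B : Finset V}

open scoped Classical in
/-- `∑_{D ∈ 𝒟^*_j} θ_D(j_D)`, i.e. the sum of `θ_D(i_D)` over the indices with `i_D = j_D`. -/
def logOdds (θ : Param I G A → ℝ) (j : Cell I A) : ℝ :=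
  ∑ x : Param I G A, if x.Matches j then θ x else 0

open scoped Classical in
/-- `1 + ∑_{j ≠ i^*} exp ∑_{D ∈ 𝒟^*_j} θ_D(j_D)`. -/
def partitionSum (θ : Param I G A → ℝ) : ℝ :=
  1 + ∑ j ∈ Finset.univ.filter (fun j : Cell I A => j ≠ 0), Real.exp (logOdds θ j)

/-- The cell probabilities `p(i)` of the model with log-linear parameter `θ`. -/
def cellProb (θ : Param I G A → ℝ) (i : Cell I A) : ℝ :=
  Real.exp (logOdds θ i) / partitionSum θ

open scoped Classical in
/-- The marginal `p^B(i_B) = ∑_{j : j_B = i_B} p(j)`. -/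
def marginal (h : B ⊆ A) (p : Cell I A → ℝ) (i : Cell I B) : ℝ :=
  ∑ j ∈ Finset.univ.filter (fun j : Cell I A => ∀ v : B, j ⟨v, h v.2⟩ = i v), p j

/-- The log-linear parameters `∑_{F ⊆ D} (-1)^{|D \ F|} log q(i_F, i^*_{F^c})` of a table `q`. -/
def logLinear (G : SimpleGraph V) (q : Cell I A → ℝ) : Param I G A → ℝ := fun x =>
  ∑ F ∈ x.D.powerset, (-1 : ℝ) ^ (x.D \ F).card * Real.log (q (x.cell F))

/-- `θ^B`: the log-linear parameter of the `B`-marginal of the model with parameter `θ`. -/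
def marginalParam (h : B ⊆ A) (θ : Param I G A → ℝ) : Param I G B → ℝ :=
  logLinear G (marginal h (cellProb θ))

/-! ### The conjugate prior -/

/-- The unnormalised conjugate prior. -/
def priorKernel (s : Param I G A → ℝ) (α : ℝ) (θ : Param I G A → ℝ) : ℝ :=
  Real.exp (∑ x, θ x * s x - α * Real.log (partitionSum θ))

/-- The prior is proper: its normalising constant is finite. -/
def IsProper (s : Param I G A → ℝ) (α : ℝ) : Prop :=
  Integrable (priorKernel s α) volume

/-- The normalising constant `I(s, α)`. -/
def normConst (s : Param I G A → ℝ) (α : ℝ) : ℝ := ∫ θ, priorKernel s α θ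

/-- The conjugate prior density `π(θ | s, α)` with respect to Lebesgue measure `dθ`. -/
def conjugatePrior (s : Param I G A → ℝ) (α : ℝ) (θ : Param I G A → ℝ) : ℝ :=
  (normConst s α)⁻¹ * priorKernel s α θ

/-- The conjugate prior as a measure. -/
def priorMeasure (s : Param I G A → ℝ) (α : ℝ) : Measure (Param I G A → ℝ) :=
  volume.withDensity (fun θ => ENNReal.ofReal (conjugatePrior s α θ))

open scoped Classical in
/-- The marginal cell probabilities `p(i_D) = ∑_{j : j_D = i_D} p(j)`, as functions of `θ`. -/
def marginalCells (θ : Param I G A → ℝ) : Param I G A → ℝ := fun x =>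
  ∑ j ∈ Finset.univ.filter (fun j : Cell I A => x.Matches j), cellProb θ j

/-- The prior induced on the cell probabilities: the law of `(p(i_D))_{D, i_D}` when `θ` follows
the conjugate prior. -/
def inducedPrior (s : Param I G A → ℝ) (α : ℝ) : Measure (Param I G A → ℝ) :=
  (priorMeasure s α).map marginalCells

/-- The Lebesgue density of the prior induced on the cell probabilities. -/
def inducedDensity (s : Param I G A → ℝ) (α : ℝ) : (Param I G A → ℝ) → ENNReal :=
  (inducedPrior s α).rnDeriv volume

end Model

end ContingencyTable

end

open ContingencyTable

set_option linter.unusedSectionVars false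

noncomputable section

namespace ContingencyTable

/-! ### Alternating sums and Möbius inversion -/

section Moebius

/-! Let `C = A ∪ B` be glued along a complete set `S = A ∩ B`, each complete subset of `C` lying in
`A` or in `B`. On `S` the log-linear model is saturated (`exists_logOdds_eq`), so every positive
table on `S` belongs to it. Hence, for fixed parameters `r` outside `S`, passing to the `S`-marginal
merely translates the parameters on `S`: `θ^S = θ|_S + restShift r` (`marginalParam_eq`). The change
of coordinates `θ ↦ (θ^S, r)` is therefore a shear, which preserves Lebesgue measure, and the prior
kernel becomes a function of `θ^S` times a function of `r` (`priorKernel_eq`). Once the `S`-cell is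
fixed, the sums over the two sides separate, so with `r = (r_A, r_B)` the second factor splits too
(`IsGluing.restKernel_eq`). The kernel on `C` is thus `k_S k_A k_B`, while those on `A` and `B` are
`k_S k_A` and `k_S k_B`. Fubini gives properness and the normalising constants, and the Markov ratio
follows (`IsGluing.conjugatePrior_eq`).

For the cell probabilities, the map `θ ↦ m` is injective with injective derivative, so the induced
laws have densities (`inducedPrior_absolutelyContinuous`). Under the prior `θ^S`, `r_A`, `r_B` are
independent; `m^S` is an injective function of `θ^S`, and `m^A`, `m^B` are functions of `(θ^S, r_A)`
and `(θ^S, r_B)`. So `m^A` and `m^B` are conditionally independent given `m^S`, and the joint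
density is `f_A f_B / f_S` (`withDensity_glue`); no Jacobian is computed.

A perfect enumeration builds `V` by a chain of such gluings (`IsPerfectEnumeration.isGluingChain`),
and induction along the chain multiplies the ratios (`IsGluingChain.markov`). -/

theorem alternating_sum_eq_zero {V : Type*} [DecidableEq V] {D : Finset V} {v : V} (hv : v ∈ D)
    (g : Finset V → ℝ) (hg : ∀ F ⊆ D, v ∉ F → g (insert v F) = g F) :
    ∑ F ∈ D.powerset, (-1 : ℝ) ^ (D \ F).card * g F = 0 := by
  obtain ⟨E, hE, rfl⟩ : ∃ E, v ∉ E ∧ insert v E = D :=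
    ⟨D.erase v, Finset.notMem_erase v D, Finset.insert_erase hv⟩
  -- Each `F` avoiding `v` is paired with `insert v F`: opposite signs, equal values of `g`.
  rw [Finset.sum_powerset_insert hE, ← Finset.sum_add_distrib]
  refine Finset.sum_eq_zero fun F hF => ?_
  rw [Finset.mem_powerset] at hF
  have hvF : v ∉ F := fun h => hE (hF h)
  have h1 : insert v E \ F = insert v (E \ F) := Finset.insert_sdiff_of_notMem _ hvF
  have h2 : insert v E \ insert v F = E \ F := by
    ext w
    simp only [Finset.mem_sdiff, Finset.mem_insert, not_or]
    constructor
    · rintro ⟨h | h, h3, h4⟩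
      · exact absurd h h3
      · exact ⟨h, h4⟩
    · rintro ⟨h, h4⟩
      exact ⟨Or.inr h, fun h5 => hE (h5 ▸ h), h4⟩
  have h3 : v ∉ E \ F := fun h => hE (Finset.mem_sdiff.1 h).1
  rw [h1, h2, Finset.card_insert_of_notMem h3, hg F (hF.trans (Finset.subset_insert _ _)) hvF,
    pow_succ]
  ring

/-! ### Indices, log-odds and Möbius inversion. -/

variable {V : Type*} {I : V → Type*} [∀ v, Zero (I v)] {G : SimpleGraph V}

theorem Param.not_matches_zero {A : Finset V} (x : Param I G A) : ¬ x.Matches (0 : Cell I A) := by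
  intro h
  obtain ⟨v, hv⟩ := x.nonempty
  exact x.level_ne ⟨v, hv⟩ (h ⟨v, hv⟩).symm

theorem Param.eq_of_D_eq {A : Finset V} {x y : Param I G A} (hD : x.D = y.D)
    (hl : ∀ v (hx : v ∈ x.D) (hy : v ∈ y.D), x.level ⟨v, hx⟩ = y.level ⟨v, hy⟩) : x = y := by
  obtain ⟨D, _, _, _, l, _⟩ := x
  obtain ⟨E, _, _, _, m, _⟩ := y
  obtain rfl : D = E := hD
  obtain rfl : l = m := funext fun v => hl v.1 v.2 v.2
  rfl

theorem Param.incl_injective {A B : Finset V} (h : B ⊆ A) :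
    Function.Injective (Param.incl h : Param I G B → Param I G A) := by
  intro x y hxy
  refine Param.eq_of_D_eq (congrArg (fun z : Param I G A => z.D) hxy) fun v hx hy => ?_
  have : ∀ z w : Param I G A, z = w → ∀ (h1 : v ∈ z.D) (h2 : v ∈ w.D),
      z.level ⟨v, h1⟩ = w.level ⟨v, h2⟩ := by
    rintro z _ rfl _ _; rfl
  exact this _ _ hxy hx hy

theorem Param.exists_incl_eq {A B : Finset V} (h : B ⊆ A) (x : Param I G A) (hx : x.D ⊆ B) :
    ∃ y : Param I G B, y.incl h = x :=
  ⟨{ x with subset := hx }, rfl⟩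

variable [Fintype V] [DecidableEq V] [∀ v, Fintype (I v)] {A B : Finset V}

theorem logOdds_zero (θ : Param I G A → ℝ) : logOdds θ 0 = 0 :=
  Finset.sum_eq_zero fun x _ => if_neg x.not_matches_zero

theorem logOdds_add (θ η : Param I G A → ℝ) (j : Cell I A) :
    logOdds (θ + η) j = logOdds θ j + logOdds η j := by
  rw [logOdds, logOdds, logOdds, ← Finset.sum_add_distrib]
  refine Finset.sum_congr rfl fun x _ => ?_
  split_ifs <;> simp

theorem logOdds_smul (c : ℝ) (θ : Param I G A → ℝ) (j : Cell I A) :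
    logOdds (c • θ) j = c * logOdds θ j := by
  rw [logOdds, logOdds, Finset.mul_sum]
  refine Finset.sum_congr rfl fun x _ => ?_
  split_ifs <;> simp

/-- The levels of `y` are nonzero and the cell vanishes off `F`, so a match forces `y.D ⊆ F`. -/
theorem Param.matches_cell_iff {x y : Param I G A} {F : Finset V} (hF : F ⊆ x.D) :
    y.Matches (x.cell F) ↔
      y.D ⊆ F ∧ ∀ v (hx : v ∈ x.D) (hy : v ∈ y.D), x.level ⟨v, hx⟩ = y.level ⟨v, hy⟩ := by
  constructor
  · intro h
    have hsub : y.D ⊆ F := by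
      intro v hv
      by_contra hvF
      have := h ⟨v, hv⟩
      simp only [Param.cell, if_neg hvF] at this
      exact y.level_ne _ this.symm
    refine ⟨hsub, fun v hx hy => ?_⟩
    have := h ⟨v, hy⟩
    simpa only [Param.cell, if_pos (hsub hy), dif_pos hx] using this
  · rintro ⟨h1, h2⟩ v
    have hx := hF (h1 v.2)
    simpa only [Param.cell, if_pos (h1 v.2), dif_pos hx] using h2 v.1 hx v.2

/-- The log-linear parameters of the table `log p = const + ∑ θ` are `θ`. -/
theorem moebius_logOdds (θ : Param I G A → ℝ) (c : ℝ) (x : Param I G A) :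
    ∑ F ∈ x.D.powerset, (-1 : ℝ) ^ (x.D \ F).card * (c + logOdds θ (x.cell F)) = θ x := by
  classical
  obtain ⟨v, hv⟩ := x.nonempty
  have hc := alternating_sum_eq_zero hv (fun _ => c) fun _ _ _ => rfl
  simp only [mul_add, Finset.sum_add_distrib, hc, zero_add, logOdds, Finset.mul_sum]
  -- The coefficient of each `θ y` is an alternating sum over `F`; only `y = x`, `F = x.D`
  -- contributes.
  rw [Finset.sum_comm, Finset.sum_eq_single x]
  · rw [Finset.sum_eq_single x.D]
    · rw [if_pos ((Param.matches_cell_iff subset_rfl).2 ⟨subset_rfl, fun _ _ _ => rfl⟩)]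
      simp
    · intro F hF hne
      rw [Finset.mem_powerset] at hF
      rw [if_neg, mul_zero]
      intro h
      exact hne (hF.antisymm ((Param.matches_cell_iff hF).1 h).1)
    · intro h
      exact absurd (Finset.mem_powerset_self _) h
  · intro y _ hyx
    -- If `x.D ⊆ y.D`, a match would force `y = x`. Otherwise some `w` in `x.D` but not in `y.D` has
    -- no effect on matching, and the alternating sum cancels.
    by_cases hxy : x.D ⊆ y.D
    · refine Finset.sum_eq_zero fun F hF => ?_
      rw [Finset.mem_powerset] at hF
      rw [if_neg, mul_zero]
      intro h
      obtain ⟨h1, h2⟩ := (Param.matches_cell_iff hF).1 h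
      exact hyx (Param.eq_of_D_eq ((h1.trans hF).antisymm hxy) fun v hy hx => (h2 v hx hy).symm)
    · obtain ⟨w, hwx, hwy⟩ := Finset.not_subset.1 hxy
      refine alternating_sum_eq_zero hwx
        (fun F => if y.Matches (x.cell F) then θ y else 0) fun F hF hwF => ?_
      have : y.Matches (x.cell (insert w F)) ↔ y.Matches (x.cell F) := by
        rw [Param.matches_cell_iff hF, Param.matches_cell_iff (Finset.insert_subset hwx hF),
          Finset.subset_insert_iff_of_notMem hwy]
      simp only [this]
  · intro h
    exact absurd (Finset.mem_univ _) h

theorem logLinear_eq_of_log {q : Cell I A → ℝ} {θ : Param I G A → ℝ} {c : ℝ}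
    (hq : ∀ i, Real.log (q i) = c + logOdds θ i) : logLinear G q = θ := by
  funext x
  simp only [logLinear, hq]
  exact moebius_logOdds θ c x

theorem logOdds_injective {θ η : Param I G A → ℝ} (h : ∀ j, logOdds θ j = logOdds η j) :
    θ = η := by
  funext x
  rw [← moebius_logOdds θ 0 x, ← moebius_logOdds η 0 x]
  simp only [h]

theorem logLinear_mul {p q : Cell I A → ℝ} (hp : ∀ i, 0 < p i) (hq : ∀ i, 0 < q i) :
    logLinear G (fun i => p i * q i) = logLinear G p + logLinear G q := by
  funext x
  simp only [logLinear, Pi.add_apply, ← Finset.sum_add_distrib]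
  refine Finset.sum_congr rfl fun F _ => ?_
  rw [Real.log_mul (hp _).ne' (hq _).ne']
  ring

open scoped Classical in
/-- The index `(supp i, i_{supp i})` of a cell `i ≠ i^*` of a complete table. -/
def Param.ofCell {S : Finset V} (hS : G.IsClique (S : Set V)) (i : {i : Cell I S // i ≠ 0}) :
    Param I G S where
  D := S.filter fun v => ∃ h : v ∈ S, i.1 ⟨v, h⟩ ≠ 0
  nonempty := by
    obtain ⟨v, hv⟩ := Function.ne_iff.1 i.2
    exact ⟨v.1, Finset.mem_filter.2 ⟨v.2, v.2, hv⟩⟩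
  subset := Finset.filter_subset _ _
  complete := hS.subset (by exact_mod_cast Finset.filter_subset _ _)
  level := fun v => i.1 ⟨v.1, (Finset.mem_filter.1 v.2).1⟩
  level_ne := fun v => (Finset.mem_filter.1 v.2).2.2

/-- Every subset of a complete set is complete, so the support of any cell is an admissible `D`.
This is the dimension count behind saturation. -/
theorem Param.ofCell_bijective {S : Finset V} (hS : G.IsClique (S : Set V)) :
    Function.Bijective (Param.ofCell (I := I) hS) := by
  classical
  constructor
  · intro i j hij
    have hD : ∀ v (h : v ∈ S), i.1 ⟨v, h⟩ ≠ 0 ↔ j.1 ⟨v, h⟩ ≠ 0 := by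
      intro v h
      have : v ∈ (Param.ofCell hS i).D ↔ v ∈ (Param.ofCell hS j).D := by rw [hij]
      simpa only [Param.ofCell, Finset.mem_filter, h, true_and, exists_true_left] using this
    have hl : ∀ x y : Param I G S, x = y → ∀ v (hx : v ∈ x.D) (hy : v ∈ y.D),
        x.level ⟨v, hx⟩ = y.level ⟨v, hy⟩ := by
      rintro x _ rfl _ _ _; rfl
    refine Subtype.ext (funext fun v => ?_)
    by_cases h : i.1 v = 0
    · rw [h, eq_comm]
      by_contra h'
      exact (hD v.1 v.2).2 h' h
    · exact hl _ _ hij v.1 (Finset.mem_filter.2 ⟨v.2, v.2, h⟩)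
        (Finset.mem_filter.2 ⟨v.2, v.2, (hD v.1 v.2).1 h⟩)
  · intro x
    have hx : x.Matches (x.cell x.D) :=
      (Param.matches_cell_iff subset_rfl).2 ⟨subset_rfl, fun _ _ _ => rfl⟩
    refine ⟨⟨x.cell x.D, fun h => x.not_matches_zero (h ▸ hx)⟩, ?_⟩
    have hmem : ∀ v, v ∈ (Param.ofCell hS ⟨x.cell x.D, fun h => x.not_matches_zero (h ▸ hx)⟩).D ↔
        v ∈ x.D := by
      intro v
      simp only [Param.ofCell, Finset.mem_filter]
      constructor
      · rintro ⟨_, h, h'⟩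
        by_contra hv
        simp [Param.cell, hv] at h'
      · intro hv
        refine ⟨x.subset hv, x.subset hv, ?_⟩
        rw [hx ⟨v, hv⟩]
        exact x.level_ne _
    exact Param.eq_of_D_eq (Finset.ext hmem) fun v _ h => hx ⟨v, h⟩

/-- On a complete set of variables the log-linear model is saturated. -/
theorem exists_logOdds_eq {S : Finset V} (hS : G.IsClique (S : Set V)) (u : Cell I S → ℝ) :
    ∃ θ : Param I G S → ℝ, ∀ i, logOdds θ i = u i - u 0 := by
  classical
  -- Möbius inversion makes this linear map injective; equality of dimensions makes it surjective.
  let L : (Param I G S → ℝ) →ₗ[ℝ] ({i : Cell I S // i ≠ 0} → ℝ) :=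
    { toFun := fun θ i => logOdds θ i.1
      map_add' := fun θ η => funext fun i => logOdds_add θ η i.1
      map_smul' := fun c θ => funext fun i => logOdds_smul c θ i.1 }
  have hinj : Function.Injective L := by
    intro θ η h
    refine logOdds_injective fun j => ?_
    by_cases hj : j = 0
    · rw [hj, logOdds_zero, logOdds_zero]
    · exact congrFun h ⟨j, hj⟩
  have hcard : Module.finrank ℝ (Param I G S → ℝ) =
      Module.finrank ℝ ({i : Cell I S // i ≠ 0} → ℝ) := by
    rw [Module.finrank_fintype_fun_eq_card, Module.finrank_fintype_fun_eq_card]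
    exact (Fintype.card_congr (Equiv.ofBijective _ (Param.ofCell_bijective hS))).symm
  obtain ⟨θ, hθ⟩ := (LinearMap.injective_iff_surjective_of_finrank_eq_finrank hcard).1 hinj
    fun i => u i.1 - u 0
  refine ⟨θ, fun i => ?_⟩
  by_cases hi : i = 0
  · rw [hi, logOdds_zero, sub_self]
  · exact congrFun hθ ⟨i, hi⟩

theorem logOdds_logLinear {S : Finset V} (hS : G.IsClique (S : Set V)) (q : Cell I S → ℝ)
    (i : Cell I S) : logOdds (logLinear G q) i = Real.log (q i) - Real.log (q 0) := by
  obtain ⟨θ, hθ⟩ := exists_logOdds_eq hS fun i => Real.log (q i)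
  rw [logLinear_eq_of_log (c := Real.log (q 0)) (θ := θ) fun i => by rw [hθ]; ring, hθ]

/-! ### Cell probabilities -/

theorem partitionSum_eq (θ : Param I G A → ℝ) :
    partitionSum θ = ∑ j : Cell I A, Real.exp (logOdds θ j) := by
  classical
  rw [partitionSum, ← Finset.add_sum_erase _ _ (Finset.mem_univ (0 : Cell I A)), logOdds_zero,
    Real.exp_zero]
  congr 1
  refine Finset.sum_congr ?_ fun _ _ => rfl
  ext j
  simp

theorem partitionSum_pos (θ : Param I G A → ℝ) : 0 < partitionSum θ := by
  exact add_pos_of_pos_of_nonneg one_pos (Finset.sum_nonneg fun _ _ => (Real.exp_pos _).le)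

theorem cellProb_pos (θ : Param I G A → ℝ) (i : Cell I A) : 0 < cellProb θ i :=
  div_pos (Real.exp_pos _) (partitionSum_pos θ)

theorem sum_cellProb (θ : Param I G A → ℝ) : ∑ i, cellProb θ i = 1 := by
  simp only [cellProb, ← Finset.sum_div, ← partitionSum_eq]
  exact div_self (partitionSum_pos θ).ne'

theorem log_cellProb (θ : Param I G A → ℝ) (i : Cell I A) :
    Real.log (cellProb θ i) = -Real.log (partitionSum θ) + logOdds θ i := by
  rw [cellProb, Real.log_div (Real.exp_pos _).ne' (partitionSum_pos θ).ne', Real.log_exp]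
  ring

theorem logLinear_cellProb (θ : Param I G A → ℝ) : logLinear G (cellProb θ) = θ :=
  logLinear_eq_of_log (log_cellProb θ)

theorem cellProb_injective : Function.Injective (cellProb : (Param I G A → ℝ) → _) :=
  Function.LeftInverse.injective logLinear_cellProb

theorem cellProb_zero (θ : Param I G A → ℝ) : cellProb θ 0 = 1 / partitionSum θ := by
  rw [cellProb, logOdds_zero, Real.exp_zero]

/-- A probability table that lies in the model has the cell probabilities of its parameter. -/
theorem cellProb_logLinear {q : Cell I A → ℝ} {θ : Param I G A → ℝ} {c : ℝ}
    (hq : ∀ i, q i = c * Real.exp (logOdds θ i)) (hc : 0 < c) (hsum : ∑ i, q i = 1) :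
    cellProb (logLinear G q) = q := by
  have hθ : logLinear G q = θ := by
    refine logLinear_eq_of_log (c := Real.log c) fun i => ?_
    rw [hq, Real.log_mul hc.ne' (Real.exp_pos _).ne', Real.log_exp]
  have hZ : c * partitionSum θ = 1 := by
    rw [partitionSum_eq, Finset.mul_sum, ← hsum]
    exact Finset.sum_congr rfl fun i _ => (hq i).symm
  have hZ' := (partitionSum_pos θ).ne'
  funext i
  rw [hθ, cellProb, hq, div_eq_iff hZ', mul_right_comm, hZ, one_mul]

/-! ### Marginal tables -/

/-- The cell `j_B` of the `B`-marginal table. -/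
def Cell.proj (h : B ⊆ A) (j : Cell I A) : Cell I B := fun v => j ⟨v, h v.2⟩

open scoped Classical in
theorem marginal_eq (h : B ⊆ A) (p : Cell I A → ℝ) (i : Cell I B) :
    marginal h p i = ∑ j : Cell I A, if Cell.proj h j = i then p j else 0 := by
  rw [marginal, ← Finset.sum_filter]
  refine Finset.sum_congr ?_ fun _ _ => rfl
  ext j
  simp only [Finset.mem_filter, funext_iff, Cell.proj]

theorem sum_marginal_mul (h : B ⊆ A) (p : Cell I A → ℝ) (f : Cell I B → ℝ) :
    ∑ i, marginal h p i * f i = ∑ j, p j * f (Cell.proj h j) := by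
  classical
  simp only [marginal_eq, Finset.sum_mul, ite_mul, zero_mul]
  rw [Finset.sum_comm]
  refine Finset.sum_congr rfl fun j _ => ?_
  simp

theorem sum_marginal (h : B ⊆ A) (p : Cell I A → ℝ) : ∑ i, marginal h p i = ∑ j, p j := by
  simpa using sum_marginal_mul h p fun _ => 1

theorem marginal_marginal {C : Finset V} (h : B ⊆ A) (h' : A ⊆ C) (p : Cell I C → ℝ) :
    marginal h (marginal h' p) = marginal (h.trans h') p := by
  classical
  funext i
  have := sum_marginal_mul h' p fun a => if Cell.proj h a = i then 1 else 0
  simp only [mul_ite, mul_one, mul_zero] at this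
  rw [marginal_eq, marginal_eq, this]
  rfl

theorem marginal_of_eq_mul (h : B ⊆ A) {p q : Cell I A → ℝ} (f : Cell I B → ℝ)
    (hp : ∀ j, p j = f (Cell.proj h j) * q j) (i : Cell I B) :
    marginal h p i = f i * marginal h q i := by
  classical
  simp only [marginal_eq, Finset.mul_sum]
  refine Finset.sum_congr rfl fun j _ => ?_
  split_ifs with hj
  · rw [hp, hj]
  · simp

theorem Cell.proj_surjective (h : B ⊆ A) :
    Function.Surjective (Cell.proj h : Cell I A → Cell I B) := by
  classical
  intro i
  exact ⟨fun v => if hv : v.1 ∈ B then i ⟨v, hv⟩ else 0, funext fun v => by simp [Cell.proj]⟩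

theorem marginal_pos (h : B ⊆ A) {p : Cell I A → ℝ} (hp : ∀ j, 0 < p j) (i : Cell I B) :
    0 < marginal h p i := by
  classical
  obtain ⟨j, hj⟩ := Cell.proj_surjective h i
  rw [marginal_eq, ← Finset.sum_filter]
  exact Finset.sum_pos (fun j _ => hp j) ⟨j, Finset.mem_filter.2 ⟨Finset.mem_univ _, hj⟩⟩

theorem marginal_refl (h : A ⊆ A) (p : Cell I A → ℝ) : marginal h p = p := by
  classical
  funext i
  have : ∀ j : Cell I A, Cell.proj h j = j := fun _ => rfl
  simp only [marginal_eq, this]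
  simp

/-- Two cells that agree on `A ∩ B` glue to a unique cell on `A ∪ B`. -/
theorem marginal_comp_proj {C S : Finset V} (hA : A ⊆ C) (hB : B ⊆ C) (hSA : S ⊆ A) (hSB : S ⊆ B)
    (hC : C ⊆ A ∪ B) (hS : A ∩ B ⊆ S) (f : Cell I B → ℝ) (i : Cell I A) :
    marginal hA (fun j => f (Cell.proj hB j)) i = marginal hSB f (Cell.proj hSA i) := by
  classical
  rw [marginal_eq, marginal_eq, ← Finset.sum_filter, ← Finset.sum_filter]
  refine Finset.sum_bij' (fun j _ => Cell.proj hB j)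
    (fun b _ => fun v => if h : v.1 ∈ A then i ⟨v, h⟩ else b ⟨v, by
      have := hC v.2
      rw [Finset.mem_union] at this
      tauto⟩) ?_ ?_ ?_ ?_ ?_
  · intro j hj
    rw [Finset.mem_filter] at hj ⊢
    exact ⟨Finset.mem_univ _, by rw [← hj.2]; rfl⟩
  · intro b _
    rw [Finset.mem_filter]
    exact ⟨Finset.mem_univ _, funext fun v => by simp [Cell.proj]⟩
  · intro j hj
    rw [Finset.mem_filter] at hj
    funext v
    by_cases hv : v.1 ∈ A
    · simp only [dif_pos hv]
      rw [← hj.2]; rfl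
    · simp only [dif_neg hv]; rfl
  · intro b hb
    rw [Finset.mem_filter] at hb
    funext v
    by_cases hv : v.1 ∈ A
    · have := congrFun hb.2 ⟨v.1, hS (Finset.mem_inter.2 ⟨hv, v.2⟩)⟩
      simp only [Cell.proj, dif_pos hv] at this ⊢
      exact this.symm
    · simp [Cell.proj, dif_neg hv]
  · intro j _
    rfl

end Moebius

/-! ### Splitting off a complete set of variables -/

section Split

variable {V : Type*} {I : V → Type*} [∀ v, Zero (I v)] {G : SimpleGraph V}

/-- The indices `(D, i_D)` on `A` with `D ⊄ S`. -/
abbrev Rest (I : V → Type*) [∀ v, Zero (I v)] (G : SimpleGraph V) (A S : Finset V) : Type _ :=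
  {x : Param I G A // ¬ x.D ⊆ S}

/-- The indices on `A` are those on `S ⊆ A` and the remaining ones. -/
def splitEquiv {A S : Finset V} (h : S ⊆ A) : Param I G S ⊕ Rest I G A S ≃ Param I G A :=
  Equiv.ofBijective (Sum.elim (Param.incl h) Subtype.val) (by
    constructor
    · rintro (x | x) (y | y) hxy
      · exact congrArg Sum.inl (Param.incl_injective h hxy)
      · exact absurd (show y.1.D ⊆ S from (show x.incl h = y.1 from hxy) ▸ x.subset) y.2
      · exact absurd (show x.1.D ⊆ S from (show x.1 = y.incl h from hxy) ▸ y.subset) x.2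
      · exact congrArg Sum.inr (Subtype.ext hxy)
    · intro x
      by_cases hx : x.D ⊆ S
      · obtain ⟨y, hy⟩ := Param.exists_incl_eq h x hx
        exact ⟨Sum.inl y, hy⟩
      · exact ⟨Sum.inr ⟨x, hx⟩, rfl⟩)

variable [DecidableEq V]

/-- The complete sets of `C = A ∪ B` lie in `A` or in `B`, and `S = A ∩ B` is complete. -/
structure IsGluing (G : SimpleGraph V) (A B S C : Finset V) : Prop where
  left_subset : A ⊆ C
  right_subset : B ⊆ C
  sep_left : S ⊆ A
  sep_right : S ⊆ B
  subset_union : C ⊆ A ∪ B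
  inter_subset : A ∩ B ⊆ S
  complete : G.IsClique (S : Set V)
  cover : ∀ D ⊆ C, G.IsClique (D : Set V) → D ⊆ A ∨ D ⊆ B

theorem IsGluing.symm {A B S C : Finset V} (h : IsGluing G A B S C) : IsGluing G B A S C where
  left_subset := h.right_subset
  right_subset := h.left_subset
  sep_left := h.sep_right
  sep_right := h.sep_left
  subset_union := by rw [Finset.union_comm]; exact h.subset_union
  inter_subset := by rw [Finset.inter_comm]; exact h.inter_subset
  complete := h.complete
  cover := fun D hD hc => (h.cover D hD hc).symm

theorem IsGluing.sep_subset {A B S C : Finset V} (h : IsGluing G A B S C) : S ⊆ C :=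
  h.sep_left.trans h.left_subset

/-- The inclusion of remaining indices. -/
def Rest.incl {A C S : Finset V} (h : A ⊆ C) (x : Rest I G A S) : Rest I G C S :=
  ⟨x.1.incl h, x.2⟩

/-- The indices on `A ∪ B` outside `A ∩ B` are those of `A` and those of `B`. -/
def IsGluing.restEquiv {A B S C : Finset V} (h : IsGluing G A B S C) :
    Rest I G A S ⊕ Rest I G B S ≃ Rest I G C S :=
  Equiv.ofBijective (Sum.elim (Rest.incl h.left_subset) (Rest.incl h.right_subset)) (by
    have hinj : ∀ {A : Finset V} (hA : A ⊆ C),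
        Function.Injective (Rest.incl hA : Rest I G A S → Rest I G C S) := fun hA x y hxy =>
      Subtype.ext (Param.incl_injective hA (congrArg Subtype.val hxy))
    have hne : ∀ (x : Rest I G A S) (y : Rest I G B S),
        Rest.incl h.left_subset x ≠ Rest.incl h.right_subset y := by
      intro x y hxy
      have hD : x.1.D = y.1.D := congrArg (fun z : Rest I G C S => z.1.D) hxy
      exact x.2 (fun v hv =>
        h.inter_subset (Finset.mem_inter.2 ⟨x.1.subset hv, y.1.subset (hD ▸ hv)⟩))
    constructor
    · rintro (x | x) (y | y) hxy
      · exact congrArg Sum.inl (hinj _ hxy)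
      · exact absurd hxy (hne x y)
      · exact absurd hxy.symm (hne y x)
      · exact congrArg Sum.inr (hinj _ hxy)
    · rintro ⟨x, hx⟩
      rcases h.cover x.D x.subset x.complete with hA | hB
      · obtain ⟨y, rfl⟩ := Param.exists_incl_eq h.left_subset x hA
        exact ⟨Sum.inl ⟨y, hx⟩, rfl⟩
      · obtain ⟨y, rfl⟩ := Param.exists_incl_eq h.right_subset x hB
        exact ⟨Sum.inr ⟨y, hx⟩, rfl⟩)

variable [Fintype V] [∀ v, Fintype (I v)] {A B S C : Finset V}

theorem sum_split (h : S ⊆ A) (f : Param I G A → ℝ) :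
    ∑ x, f x = ∑ y : Param I G S, f (y.incl h) + ∑ x : Rest I G A S, f x.1 := by
  rw [← (splitEquiv h).sum_comp f, Fintype.sum_sum_type]
  rfl

theorem IsGluing.sum_rest (h : IsGluing G A B S C) (f : Rest I G C S → ℝ) :
    ∑ x, f x = ∑ x : Rest I G A S, f (Rest.incl h.left_subset x) +
      ∑ x : Rest I G B S, f (Rest.incl h.right_subset x) := by
  rw [← h.restEquiv.sum_comp f, Fintype.sum_sum_type]
  rfl

/-- The restriction of a parameter on `A` to the indices outside `S`. -/
def rest (S : Finset V) (θ : Param I G A → ℝ) : Rest I G A S → ℝ := fun x => θ x.1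

open scoped Classical in
/-- The part of `logOdds` that comes from the indices outside `S`. -/
def restOdds (r : Rest I G A S → ℝ) (j : Cell I A) : ℝ :=
  ∑ x : Rest I G A S, if x.1.Matches j then r x else 0

theorem logOdds_split (h : S ⊆ A) (θ : Param I G A → ℝ) (j : Cell I A) :
    logOdds θ j = logOdds (restrictTo h θ) (Cell.proj h j) + restOdds (rest S θ) j :=
  sum_split h _

theorem IsGluing.restOdds_eq (h : IsGluing G A B S C) (r : Rest I G C S → ℝ) (j : Cell I C) :
    restOdds r j =
      restOdds (r ∘ Rest.incl h.left_subset) (Cell.proj h.left_subset j) +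
      restOdds (r ∘ Rest.incl h.right_subset) (Cell.proj h.right_subset j) :=
  h.sum_rest _

/-- The contribution of the indices outside `S` to the `S`-marginal table. -/
def restTable (h : S ⊆ A) (r : Rest I G A S → ℝ) : Cell I S → ℝ :=
  marginal h fun j => Real.exp (restOdds r j)

theorem restTable_pos (h : S ⊆ A) (r : Rest I G A S → ℝ) (i : Cell I S) : 0 < restTable h r i :=
  marginal_pos h (fun _ => Real.exp_pos _) i

/-- The shift of the parameters on `S` caused by the parameters outside `S`. -/
def restShift (h : S ⊆ A) (r : Rest I G A S → ℝ) : Param I G S → ℝ :=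
  logLinear G (restTable h r)

/-- Saturation on `S` puts this positive table in the model, whatever `r` is; the constant is its
value at the reference cell. -/
theorem restTable_eq (h : S ⊆ A) (hS : G.IsClique (S : Set V)) (r : Rest I G A S → ℝ)
    (i : Cell I S) :
    restTable h r i = restTable h r 0 * Real.exp (logOdds (restShift h r) i) := by
  rw [restShift, logOdds_logLinear hS, Real.exp_sub, Real.exp_log (restTable_pos h r i),
    Real.exp_log (restTable_pos h r 0), mul_div_cancel₀ _ (restTable_pos h r 0).ne']

/-- The factor from indices inside `S` depends only on the `S`-cell and leaves the sum; what remains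
is `restTable`, itself log-linear on `S`. -/
theorem marginal_cellProb (h : S ⊆ A) (hS : G.IsClique (S : Set V)) (θ : Param I G A → ℝ)
    (i : Cell I S) :
    marginal h (cellProb θ) i = restTable h (rest S θ) 0 / partitionSum θ *
      Real.exp (logOdds (restrictTo h θ + restShift h (rest S θ)) i) := by
  rw [marginal_of_eq_mul h (q := fun j => Real.exp (restOdds (rest S θ) j))
    (fun i => Real.exp (logOdds (restrictTo h θ) i) / partitionSum θ) (fun j => ?_) i]
  · rw [← restTable, restTable_eq h hS, logOdds_add, Real.exp_add]
    ring
  · rw [cellProb, logOdds_split h, Real.exp_add]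
    ring

/-- For fixed parameters outside `S`, passing to the `S`-marginal translates the parameters. -/
theorem marginalParam_eq (h : S ⊆ A) (hS : G.IsClique (S : Set V)) (θ : Param I G A → ℝ) :
    marginalParam h θ = restrictTo h θ + restShift h (rest S θ) := by
  have hpos : 0 < restTable h (rest S θ) 0 / partitionSum θ :=
    div_pos (restTable_pos _ _ _) (partitionSum_pos θ)
  refine logLinear_eq_of_log (c := Real.log (restTable h (rest S θ) 0 / partitionSum θ))
    fun i => ?_
  rw [marginal_cellProb h hS, Real.log_mul hpos.ne' (Real.exp_pos _).ne', Real.log_exp]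

theorem cellProb_marginalParam_of_isClique (h : S ⊆ A) (hS : G.IsClique (S : Set V))
    (θ : Param I G A → ℝ) : cellProb (marginalParam h θ) = marginal h (cellProb θ) :=
  cellProb_logLinear (marginal_cellProb h hS θ)
    (div_pos (restTable_pos _ _ _) (partitionSum_pos θ)) (by rw [sum_marginal, sum_cellProb])

/-- A partition sum is the reciprocal of the probability of the reference cell. -/
theorem partitionSum_marginalParam (h : S ⊆ A) (hS : G.IsClique (S : Set V))
    (θ : Param I G A → ℝ) :
    partitionSum (marginalParam h θ) = partitionSum θ / restTable h (rest S θ) 0 := by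
  have h1 := cellProb_zero (marginalParam h θ)
  rw [cellProb_marginalParam_of_isClique h hS, marginal_cellProb h hS, logOdds_zero, Real.exp_zero,
    mul_one] at h1
  rw [← one_div_one_div (partitionSum (marginalParam h θ)), ← h1, one_div_div]

/-- The factor of the conjugate prior that involves the parameters outside `S`. -/
def restKernel (h : S ⊆ A) (s : Param I G A → ℝ) (α : ℝ) (r : Rest I G A S → ℝ) : ℝ :=
  Real.exp (∑ x, r x * s x.1 - ∑ y, restShift h r y * s (y.incl h) -
    α * Real.log (restTable h r 0))

theorem restKernel_pos (h : S ⊆ A) (s : Param I G A → ℝ) (α : ℝ) (r : Rest I G A S → ℝ) :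
    0 < restKernel h s α r :=
  Real.exp_pos _

/-- Substituting `θ|_S = θ^S - restShift r` in the linear exponent, and `Z(θ) = Z(θ^S) * restTable r
0`, leaves correction terms in `r` alone. -/
theorem priorKernel_eq (h : S ⊆ A) (hS : G.IsClique (S : Set V)) (s : Param I G A → ℝ) (α : ℝ)
    (θ : Param I G A → ℝ) :
    priorKernel s α θ =
      priorKernel (restrictTo h s) α (marginalParam h θ) * restKernel h s α (rest S θ) := by
  rw [priorKernel, priorKernel, restKernel, ← Real.exp_add, partitionSum_marginalParam h hS,
    Real.log_div (partitionSum_pos θ).ne' (restTable_pos _ _ _).ne', marginalParam_eq h hS,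
    sum_split h]
  congr 1
  simp only [Pi.add_apply, restrictTo, rest, add_mul, Finset.sum_add_distrib]
  ring

/-! ### Gluing two tables along a complete separator -/

/-- Marginalising first to `A` turns the `B`-part into a function of the `S`-cell, which then leaves
the sum from `A` down to `S`. -/
theorem IsGluing.restTable_eq (h : IsGluing G A B S C) (r : Rest I G C S → ℝ) :
    restTable h.sep_subset r = fun i =>
      restTable h.sep_left (r ∘ Rest.incl h.left_subset) i *
      restTable h.sep_right (r ∘ Rest.incl h.right_subset) i := by
  funext i
  have h2 : ∀ a, marginal h.left_subset (fun j => Real.exp (restOdds r j)) a =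
      restTable h.sep_right (r ∘ Rest.incl h.right_subset) (Cell.proj h.sep_left a) *
      Real.exp (restOdds (r ∘ Rest.incl h.left_subset) a) := by
    intro a
    rw [marginal_of_eq_mul h.left_subset
      (q := fun j => Real.exp
        (restOdds (r ∘ Rest.incl h.right_subset) (Cell.proj h.right_subset j)))
      (fun a => Real.exp (restOdds (r ∘ Rest.incl h.left_subset) a))
      (fun j => by rw [h.restOdds_eq, Real.exp_add]) a,
      marginal_comp_proj h.left_subset h.right_subset h.sep_left
      h.sep_right h.subset_union h.inter_subset
      (fun b => Real.exp (restOdds (r ∘ Rest.incl h.right_subset) b)), mul_comm]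
    rfl
  rw [restTable, ← marginal_marginal h.sep_left h.left_subset,
    marginal_of_eq_mul h.sep_left _ h2, mul_comm]
  rfl

theorem IsGluing.restShift_eq (h : IsGluing G A B S C) (r : Rest I G C S → ℝ) :
    restShift h.sep_subset r = restShift h.sep_left (r ∘ Rest.incl h.left_subset) +
      restShift h.sep_right (r ∘ Rest.incl h.right_subset) := by
  rw [restShift, h.restTable_eq, logLinear_mul (restTable_pos _ _) (restTable_pos _ _)]
  rfl

theorem IsGluing.restKernel_eq (h : IsGluing G A B S C) (s : Param I G C → ℝ) (α : ℝ)
    (r : Rest I G C S → ℝ) :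
    restKernel h.sep_subset s α r =
      restKernel h.sep_left (restrictTo h.left_subset s) α (r ∘ Rest.incl h.left_subset) *
      restKernel h.sep_right (restrictTo h.right_subset s) α
        (r ∘ Rest.incl h.right_subset) := by
  rw [restKernel, restKernel, restKernel, ← Real.exp_add, h.restTable_eq, h.restShift_eq,
    Real.log_mul (restTable_pos _ _ _).ne' (restTable_pos _ _ _).ne', h.sum_rest]
  congr 1
  simp only [Pi.add_apply, add_mul, Finset.sum_add_distrib]
  simp only [restrictTo, Function.comp_apply]
  simp only [Rest.incl, Param.incl]
  ring

/-- Extension of a parameter on `S` by zero. -/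
def extendZero (A : Finset V) (η : Param I G S → ℝ) : Param I G A → ℝ := fun x =>
  if h : x.D ⊆ S then η { x with subset := h } else 0

theorem logOdds_extendZero (h : S ⊆ A) (η : Param I G S → ℝ) (j : Cell I A) :
    logOdds (extendZero A η) j = logOdds η (Cell.proj h j) := by
  have h1 : restrictTo h (extendZero A η) = η := funext fun x => dif_pos x.subset
  have h2 : restOdds (rest S (extendZero A η)) j = 0 :=
    Finset.sum_eq_zero fun x _ => by
      have : rest S (extendZero A η) x = 0 := dif_neg x.2
      simp [this]
  rw [logOdds_split h, h1, h2, add_zero]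

/-- Collapsibility onto `A`: summing out the rest of `B` yields a table on the complete set `S`,
whose log-linear parameters are absorbed into those of `A`. -/
theorem IsGluing.marginal_cellProb (h : IsGluing G A B S C) (θ : Param I G C → ℝ)
    (i : Cell I A) :
    marginal h.left_subset (cellProb θ) i =
      restTable h.sep_right (rest S θ ∘ Rest.incl h.right_subset) 0 / partitionSum θ *
      Real.exp (logOdds (restrictTo h.left_subset θ +
        extendZero A (restShift h.sep_right (rest S θ ∘ Rest.incl h.right_subset))) i) := by
  rw [marginal_of_eq_mul h.left_subset
    (q := fun j => Real.exp
      (restOdds (rest S θ ∘ Rest.incl h.right_subset) (Cell.proj h.right_subset j)))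
    (fun i => Real.exp (logOdds (restrictTo h.left_subset θ) i) / partitionSum θ)
    (fun j => ?_) i]
  · rw [marginal_comp_proj h.left_subset h.right_subset h.sep_left
      h.sep_right h.subset_union h.inter_subset
      (fun b => Real.exp (restOdds (rest S θ ∘ Rest.incl h.right_subset) b)), ← restTable,
      ContingencyTable.restTable_eq h.sep_right h.complete, logOdds_add,
      logOdds_extendZero h.sep_left, Real.exp_add]
    ring
  · rw [cellProb, logOdds_split h.sep_subset, h.restOdds_eq,
      logOdds_split h.sep_left (restrictTo h.left_subset θ), ← add_assoc, Real.exp_add,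
      mul_div_right_comm]
    rfl

theorem IsGluing.marginalParam_eq (h : IsGluing G A B S C) (θ : Param I G C → ℝ) :
    marginalParam h.left_subset θ = restrictTo h.left_subset θ +
        extendZero A (restShift h.sep_right (rest S θ ∘ Rest.incl h.right_subset)) := by
  have hpos : 0 < restTable h.sep_right (rest S θ ∘ Rest.incl h.right_subset) 0 / partitionSum θ :=
    div_pos (restTable_pos _ _ _) (partitionSum_pos θ)
  refine logLinear_eq_of_log (c := Real.log
    (restTable h.sep_right (rest S θ ∘ Rest.incl h.right_subset) 0 / partitionSum θ)) fun i => ?_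
  rw [h.marginal_cellProb, Real.log_mul hpos.ne' (Real.exp_pos _).ne', Real.log_exp]

theorem IsGluing.cellProb_marginalParam (h : IsGluing G A B S C) (θ : Param I G C → ℝ) :
    cellProb (marginalParam h.left_subset θ) = marginal h.left_subset (cellProb θ) :=
  cellProb_logLinear (h.marginal_cellProb θ)
    (div_pos (restTable_pos _ _ _) (partitionSum_pos θ)) (by rw [sum_marginal, sum_cellProb])

/-- The `A`-marginal lies in the model on `A`, so its parameter determines it and further marginals
can be read off. -/
theorem IsGluing.marginalParam_marginalParam (h : IsGluing G A B S C) {T : Finset V}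
    (hT : T ⊆ A) (θ : Param I G C → ℝ) :
    marginalParam hT (marginalParam h.left_subset θ) =
      marginalParam (hT.trans h.left_subset) θ := by
  rw [marginalParam, h.cellProb_marginalParam, marginal_marginal]
  rfl

/-- The correction in `IsGluing.marginalParam_eq` is supported on indices inside `S`. -/
theorem IsGluing.rest_marginalParam (h : IsGluing G A B S C) (θ : Param I G C → ℝ) :
    rest S (marginalParam h.left_subset θ) = rest S θ ∘ Rest.incl h.left_subset := by
  rw [h.marginalParam_eq]
  funext x
  have : extendZero A (restShift h.sep_right (rest S θ ∘ Rest.incl h.right_subset)) x.1 = 0 :=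
    dif_neg x.2
  rw [rest, Pi.add_apply, this, add_zero]
  rfl

theorem IsGluing.priorKernel_eq (h : IsGluing G A B S C) (s : Param I G C → ℝ) (α : ℝ)
    (θ : Param I G C → ℝ) :
    priorKernel s α θ =
      priorKernel (restrictTo h.sep_subset s) α (marginalParam h.sep_subset θ) *
      (restKernel h.sep_left (restrictTo h.left_subset s) α
          (rest S (marginalParam h.left_subset θ)) *
        restKernel h.sep_right (restrictTo h.right_subset s) α
          (rest S (marginalParam h.right_subset θ))) := by
  rw [ContingencyTable.priorKernel_eq h.sep_subset h.complete, h.restKernel_eq,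
    h.rest_marginalParam, h.symm.rest_marginalParam]

theorem IsGluing.priorKernel_left (h : IsGluing G A B S C) (s : Param I G C → ℝ) (α : ℝ)
    (θ : Param I G C → ℝ) :
    priorKernel (restrictTo h.left_subset s) α (marginalParam h.left_subset θ) =
      priorKernel (restrictTo h.sep_subset s) α (marginalParam h.sep_subset θ) *
      restKernel h.sep_left (restrictTo h.left_subset s) α
          (rest S (marginalParam h.left_subset θ)) := by
  rw [ContingencyTable.priorKernel_eq h.sep_left h.complete, h.marginalParam_marginalParam]
  rfl

/-! ### The marginal cell probabilities -/

theorem restrictTo_marginalCells (h : B ⊆ A) (θ : Param I G A → ℝ) (η : Param I G B → ℝ)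
    (hη : cellProb η = marginal h (cellProb θ)) :
    restrictTo h (marginalCells θ) = marginalCells η := by
  classical
  funext x
  have := sum_marginal_mul h (cellProb θ) fun i => if x.Matches i then 1 else 0
  simp only [mul_ite, mul_one, mul_zero] at this
  rw [marginalCells, hη, Finset.sum_filter, this, restrictTo, marginalCells, Finset.sum_filter]
  rfl

theorem restrictTo_marginalCells_of_isClique (h : S ⊆ A) (hS : G.IsClique (S : Set V))
    (θ : Param I G A → ℝ) :
    restrictTo h (marginalCells θ) = marginalCells (marginalParam h θ) :=
  restrictTo_marginalCells h θ _ (cellProb_marginalParam_of_isClique h hS θ)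

theorem IsGluing.restrictTo_marginalCells (h : IsGluing G A B S C) (θ : Param I G C → ℝ) :
    restrictTo h.left_subset (marginalCells θ) = marginalCells (marginalParam h.left_subset θ) :=
  ContingencyTable.restrictTo_marginalCells _ θ _ (h.cellProb_marginalParam θ)

end Split

/-! ### The mean parametrisation -/

section Mean

variable {V : Type*} {I : V → Type*} [∀ v, Zero (I v)] {G : SimpleGraph V}
  [Fintype V] [DecidableEq V] [∀ v, Fintype (I v)] {A : Finset V}

/-- `logOdds` as a linear form in the parameter. -/
def logOddsCLM (j : Cell I A) : (Param I G A → ℝ) →L[ℝ] ℝ :=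
  LinearMap.toContinuousLinearMap
    { toFun := fun θ => logOdds θ j
      map_add' := fun θ η => logOdds_add θ η j
      map_smul' := fun c θ => logOdds_smul c θ j }

theorem differentiable_logOdds (j : Cell I A) :
    Differentiable ℝ fun θ : Param I G A → ℝ => logOdds θ j :=
  (logOddsCLM j).differentiable

theorem differentiable_partitionSum :
    Differentiable ℝ (partitionSum : (Param I G A → ℝ) → ℝ) := by
  have h : (partitionSum : (Param I G A → ℝ) → ℝ) =
      fun θ => ∑ j : Cell I A, Real.exp (logOdds θ j) := funext partitionSum_eq
  rw [h]
  exact Differentiable.fun_sum fun j _ => (differentiable_logOdds j).exp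

theorem differentiable_cellProb (j : Cell I A) :
    Differentiable ℝ fun θ : Param I G A → ℝ => cellProb θ j := by
  simp only [cellProb, div_eq_mul_inv]
  exact (differentiable_logOdds j).exp.mul
    (differentiable_partitionSum.inv fun θ => (partitionSum_pos θ).ne')

theorem differentiable_marginalCells :
    Differentiable ℝ (marginalCells : (Param I G A → ℝ) → _) :=
  differentiable_pi.2 fun _ => Differentiable.fun_sum fun j _ => differentiable_cellProb j

theorem measurable_marginalCells : Measurable (marginalCells : (Param I G A → ℝ) → _) :=
  differentiable_marginalCells.continuous.measurable

/-- The duality between mean and natural parameters, from which both injectivity statements below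
follow. -/
theorem sum_marginalCells_mul (θ ζ : Param I G A → ℝ) :
    ∑ x, marginalCells θ x * ζ x = ∑ j, cellProb θ j * logOdds ζ j := by
  classical
  simp only [marginalCells, logOdds, Finset.sum_filter, Finset.sum_mul, Finset.mul_sum]
  rw [Finset.sum_comm]
  refine Finset.sum_congr rfl fun j _ => Finset.sum_congr rfl fun x _ => ?_
  split_ifs <;> simp

/-- For the tables `p`, `q` of `θ`, `η`, the sum of `(p - q)(log p - log q)` equals the pairing of
the difference of means with `θ - η`, since both tables have total mass 1. It vanishes when the
means agree; its terms are nonnegative, so `p = q`. -/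
theorem marginalCells_injective :
    Function.Injective (marginalCells : (Param I G A → ℝ) → _) := by
  intro θ η h
  have h1 : ∑ j, (cellProb θ j - cellProb η j) *
      (Real.log (cellProb θ j) - Real.log (cellProb η j)) = 0 := by
    have e1 := sum_marginalCells_mul θ θ
    have e2 := sum_marginalCells_mul θ η
    have e3 := sum_marginalCells_mul η θ
    have e4 := sum_marginalCells_mul η η
    rw [h] at e1 e2
    have : ∀ j : Cell I A, (cellProb θ j - cellProb η j) *
        (Real.log (cellProb θ j) - Real.log (cellProb η j)) =
        (cellProb θ j * logOdds θ j - cellProb θ j * logOdds η j) -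
        (cellProb η j * logOdds θ j - cellProb η j * logOdds η j) +
        (cellProb θ j - cellProb η j) *
          (Real.log (partitionSum η) - Real.log (partitionSum θ)) := fun j => by
      rw [log_cellProb, log_cellProb]; ring
    simp only [this, Finset.sum_add_distrib, Finset.sum_sub_distrib, ← Finset.sum_mul,
      sum_cellProb, ← e1, ← e2, ← e3, ← e4]
    ring
  have h2 : ∀ j : Cell I A, 0 ≤ (cellProb θ j - cellProb η j) *
      (Real.log (cellProb θ j) - Real.log (cellProb η j)) := by
    intro j
    rcases le_total (cellProb θ j) (cellProb η j) with hle | hle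
    · exact mul_nonneg_of_nonpos_of_nonpos (sub_nonpos.2 hle)
        (sub_nonpos.2 (Real.log_le_log (cellProb_pos _ _) hle))
    · exact mul_nonneg (sub_nonneg.2 hle)
        (sub_nonneg.2 (Real.log_le_log (cellProb_pos _ _) hle))
  refine cellProb_injective (funext fun j => ?_)
  have h3 := (Finset.sum_eq_zero_iff_of_nonneg fun j _ => h2 j).1 h1 j (Finset.mem_univ _)
  rcases mul_eq_zero.1 h3 with h4 | h4
  · exact sub_eq_zero.1 h4
  · exact Real.log_injOn_pos (cellProb_pos _ _) (cellProb_pos _ _) (sub_eq_zero.1 h4)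

/-- The Fisher information is nondegenerate. -/
theorem fderiv_marginalCells_injective (θ : Param I G A → ℝ) :
    Function.Injective (fderiv ℝ marginalCells θ) := by
  rw [injective_iff_map_eq_zero]
  intro ζ hζ
  set e : Cell I A → ℝ := fun j => Real.exp (logOdds θ j)
  set l : Cell I A → ℝ := fun j => logOdds ζ j
  have hZ : 0 < ∑ j, e j := by
    rw [← partitionSum_eq]; exact partitionSum_pos θ
  have hline : HasDerivAt (fun t : ℝ => θ + t • ζ) ζ 0 := by
    simpa using ((hasDerivAt_id (0 : ℝ)).smul_const ζ).const_add θ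
  -- As `ζ` is in the kernel, the pairing of the means with `ζ` is stationary along the line `θ + t
  -- • ζ`.
  have h1 : HasDerivAt (fun t : ℝ => ∑ x, marginalCells (θ + t • ζ) x * ζ x) 0 0 := by
    have hf : HasFDerivAt marginalCells (fderiv ℝ marginalCells θ) (θ + (0 : ℝ) • ζ) := by
      simpa using (differentiable_marginalCells θ).hasFDerivAt
    have hd := hf.comp_hasDerivAt (0 : ℝ) hline
    rw [hζ, hasDerivAt_pi] at hd
    have := HasDerivAt.fun_sum (u := Finset.univ) fun x _ => (hd x).mul_const (ζ x)
    simpa using this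
  have hexp : ∀ j, HasDerivAt (fun t : ℝ => Real.exp (logOdds (θ + t • ζ) j)) (e j * l j) 0 := by
    intro j
    have : HasDerivAt (fun t : ℝ => logOdds θ j + t * logOdds ζ j) (l j) 0 := by
      simpa using ((hasDerivAt_id (0 : ℝ)).mul_const (l j)).const_add (logOdds θ j)
    simpa [logOdds_add, logOdds_smul] using this.exp
  -- The same derivative, from the quotient rule, is the variance of `l` under `cellProb θ`.
  have h2 : HasDerivAt (fun t : ℝ => ∑ x, marginalCells (θ + t • ζ) x * ζ x)
      (((∑ j, e j * l j * l j) * ∑ j, e j - (∑ j, e j * l j) * ∑ j, e j * l j) /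
        (∑ j, e j) ^ 2) 0 := by
    have hn : HasDerivAt (fun t : ℝ => ∑ j, Real.exp (logOdds (θ + t • ζ) j) * l j)
        (∑ j, e j * l j * l j) 0 := HasDerivAt.fun_sum fun j _ => (hexp j).mul_const (l j)
    have hd : HasDerivAt (fun t : ℝ => ∑ j : Cell I A, Real.exp (logOdds (θ + t • ζ) j))
        (∑ j, e j * l j) 0 := HasDerivAt.fun_sum fun j _ => hexp j
    have h0 : ∑ j : Cell I A, Real.exp (logOdds (θ + (0 : ℝ) • ζ) j) = ∑ j, e j := by simp [e]
    have h0' : ∑ j : Cell I A, Real.exp (logOdds (θ + (0 : ℝ) • ζ) j) * l j =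
        ∑ j, e j * l j := by simp [e]
    have hq := hn.fun_div hd (by rw [h0]; exact hZ.ne')
    rw [h0, h0'] at hq
    refine hq.congr_of_eventuallyEq (Filter.Eventually.of_forall fun t => ?_)
    simp only [sum_marginalCells_mul, cellProb, partitionSum_eq, Finset.sum_div]
    exact Finset.sum_congr rfl fun j _ => div_mul_eq_mul_div _ _ _
  have h3 := h2.unique h1
  rw [div_eq_zero_iff, or_iff_left (pow_pos hZ 2).ne'] at h3
  set c := (∑ j, e j * l j) / ∑ j, e j with hc
  have hcZ : c * ∑ j, e j = ∑ j, e j * l j := div_mul_cancel₀ _ hZ.ne'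
  -- Zero variance about the mean `c`, so `l` is constant; its value at the reference cell is `0`.
  have h4 : ∑ j, e j * (l j - c) ^ 2 = 0 := by
    have : ∀ j, e j * (l j - c) ^ 2 = e j * l j * l j - 2 * c * (e j * l j) + c ^ 2 * e j :=
      fun j => by ring
    simp only [this, Finset.sum_add_distrib, Finset.sum_sub_distrib, ← Finset.mul_sum]
    have h5 : (∑ j, e j * l j * l j - c * ∑ j, e j * l j) * ∑ j, e j = 0 := by
      rw [sub_mul, ← h3, mul_right_comm, hcZ]
    have h6 := (mul_eq_zero.1 h5).resolve_right hZ.ne'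
    rw [sq, mul_assoc c c, hcZ]
    linarith
  have h5 : ∀ j, l j = c := by
    intro j
    have := (Finset.sum_eq_zero_iff_of_nonneg fun j _ =>
      mul_nonneg (Real.exp_pos _).le (sq_nonneg (l j - c))).1 h4 j (Finset.mem_univ _)
    have := (mul_eq_zero.1 this).resolve_left (Real.exp_pos _).ne'
    exact sub_eq_zero.1 (pow_eq_zero_iff two_ne_zero |>.1 this)
  refine logOdds_injective fun j => ?_
  have h0 : l 0 = 0 := logOdds_zero ζ
  have : logOdds (0 : Param I G A → ℝ) j = 0 := by simp [logOdds]
  rw [this, ← h0, h5 0]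
  exact h5 j

/-- By change of variables, the integral of `|det f'|` over the preimage of a null set is the
measure of a subset of that null set, hence zero; the determinant never vanishes, so the preimage is
null. -/
theorem quasiMeasurePreserving_of_injective_fderiv {E : Type*} [NormedAddCommGroup E]
    [NormedSpace ℝ E] [FiniteDimensional ℝ E] [MeasurableSpace E] [BorelSpace E] (μ : Measure E)
    [μ.IsAddHaarMeasure] {f : E → E} (hf : Differentiable ℝ f) (hinj : Function.Injective f)
    (hf' : ∀ x, Function.Injective (fderiv ℝ f x)) : Measure.QuasiMeasurePreserving f μ μ := by
  refine ⟨hf.continuous.measurable, Measure.AbsolutelyContinuous.mk fun N hN h0 => ?_⟩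
  rw [Measure.map_apply hf.continuous.measurable hN]
  have hs : MeasurableSet (f ⁻¹' N) := hf.continuous.measurable hN
  have h1 := lintegral_abs_det_fderiv_eq_addHaar_image μ hs
    (fun x _ => (hf x).hasFDerivAt.hasFDerivWithinAt) hinj.injOn
  have h2 : μ (f '' (f ⁻¹' N)) = 0 := measure_mono_null (Set.image_preimage_subset f N) h0
  have hm : Measurable fun x => ENNReal.ofReal |(fderiv ℝ f x).det| :=
    ((ContinuousLinearMap.continuous_det.measurable.comp
      (measurable_fderiv ℝ f)).abs).ennreal_ofReal
  rw [h2, lintegral_eq_zero_iff hm] at h1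
  rw [← Measure.restrict_eq_zero, ← ae_eq_bot, ← Filter.eventually_false_iff_eq_bot]
  filter_upwards [h1] with x hx
  simp only [Pi.zero_apply, ENNReal.ofReal_eq_zero, abs_nonpos_iff] at hx
  have hu : IsUnit (fderiv ℝ f x : E →ₗ[ℝ] E) :=
    (LinearMap.isUnit_iff_ker_eq_bot _).2 (LinearMap.ker_eq_bot.2 (hf' x))
  exact ((LinearMap.isUnit_iff_isUnit_det _).1 hu).ne_zero hx

theorem quasiMeasurePreserving_marginalCells :
    Measure.QuasiMeasurePreserving (marginalCells : (Param I G A → ℝ) → _) volume volume :=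
  quasiMeasurePreserving_of_injective_fderiv volume differentiable_marginalCells
    marginalCells_injective fderiv_marginalCells_injective

theorem inducedPrior_absolutelyContinuous (s : Param I G A → ℝ) (α : ℝ) :
    inducedPrior s α ≪ volume :=
  ((withDensity_absolutelyContinuous _ _).map measurable_marginalCells).trans
    quasiMeasurePreserving_marginalCells.absolutelyContinuous

/-- Allows functions of `θ^S` to be rewritten as measurable functions of `m^S`. -/
theorem measurableEmbedding_marginalCells :
    MeasurableEmbedding (marginalCells : (Param I G A → ℝ) → _) :=
  differentiable_marginalCells.continuous.measurableEmbedding marginalCells_injective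

end Mean

/-! ### Products of normalised densities -/

section Gibbs

variable {T X Y : Type*} [MeasurableSpace T] [MeasurableSpace X] [MeasurableSpace Y]

/-- The probability measure with density proportional to `g`. -/
def gibbs (μ : Measure T) (g : T → ℝ) : Measure T :=
  μ.withDensity fun x => ENNReal.ofReal ((∫ t, g t ∂μ)⁻¹ * g x)

instance (μ : Measure T) [SFinite μ] (g : T → ℝ) : SFinite (gibbs μ g) := by
  unfold gibbs; infer_instance

theorem integral_pos_of_pos {μ : Measure T} [NeZero μ] {g : T → ℝ} (hg : Integrable g μ)
    (hpos : ∀ x, 0 < g x) : 0 < ∫ x, g x ∂μ := by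
  rw [integral_pos_iff_support_of_nonneg (fun x => (hpos x).le) hg]
  have : Function.support g = Set.univ := Set.eq_univ_of_forall fun x => (hpos x).ne'
  rw [this, pos_iff_ne_zero, Ne, Measure.measure_univ_eq_zero]
  exact NeZero.ne μ

theorem isProbabilityMeasure_gibbs {μ : Measure T} [NeZero μ] {g : T → ℝ} (hg : Integrable g μ)
    (hpos : ∀ x, 0 < g x) : IsProbabilityMeasure (gibbs μ g) := by
  have h := integral_pos_of_pos hg hpos
  constructor
  rw [gibbs, withDensity_apply _ MeasurableSet.univ, Measure.restrict_univ,
    ← ofReal_integral_eq_lintegral_ofReal (hg.const_mul _)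
      (Filter.Eventually.of_forall fun x => mul_nonneg (inv_nonneg.2 h.le) (hpos x).le),
    integral_const_mul, inv_mul_cancel₀ h.ne', ENNReal.ofReal_one]

theorem map_withDensity_of_measurePreserving {μ : Measure T} {ν : Measure X} (e : T ≃ᵐ X)
    (he : MeasurePreserving e μ ν) (f : T → ENNReal) :
    (μ.withDensity f).map e = ν.withDensity (f ∘ e.symm) := by
  ext s hs
  rw [e.map_apply, withDensity_apply _ (e.measurable hs), withDensity_apply _ hs, ← he.map_eq,
    e.restrict_map, lintegral_map_equiv]
  simp

variable {μ : Measure T} {μX : Measure X} {μY : Measure Y} [SFinite μX] [SFinite μY]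
  (e : T ≃ᵐ X × Y) {g : T → ℝ} {a : X → ℝ} {b : Y → ℝ}

/-- Almost every section of an integrable function on a product is integrable; a section of `a * b`
is one factor times a positive constant. Nonzero measures guarantee that such a section exists. -/
theorem integrable_iff_of_factor [NeZero μX] [NeZero μY] (he : MeasurePreserving e μ (μX.prod μY))
    (hg : ∀ t, g t = a (e t).1 * b (e t).2) (ha : ∀ x, 0 < a x) (hb : ∀ y, 0 < b y) :
    Integrable g μ ↔ Integrable a μX ∧ Integrable b μY := by
  have hge : g = (fun p : X × Y => a p.1 * b p.2) ∘ e := funext hg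
  rw [hge, he.integrable_comp_emb e.measurableEmbedding]
  constructor
  · intro h
    obtain ⟨x, hx⟩ := h.prod_right_ae.exists
    obtain ⟨y, hy⟩ := h.prod_left_ae.exists
    exact ⟨by simpa [(hb y).ne'] using hy.mul_const (b y)⁻¹,
      by simpa [(ha x).ne', ← mul_assoc] using hx.const_mul (a x)⁻¹⟩
  · rintro ⟨h1, h2⟩
    exact h1.mul_prod h2

theorem integral_of_factor (he : MeasurePreserving e μ (μX.prod μY))
    (hg : ∀ t, g t = a (e t).1 * b (e t).2) :
    ∫ t, g t ∂μ = (∫ x, a x ∂μX) * ∫ y, b y ∂μY := by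
  simp only [hg]
  rw [he.integral_comp e.measurableEmbedding (fun p : X × Y => a p.1 * b p.2),
    integral_prod_mul]

/-- Integrability is not required: a divergent integral has the default value `0`, and then both
sides are the zero measure. -/
theorem map_gibbs_of_factor (he : MeasurePreserving e μ (μX.prod μY))
    (hg : ∀ t, g t = a (e t).1 * b (e t).2) (ha : ∀ x, 0 ≤ a x) (ham : Measurable a)
    (hbm : Measurable b) :
    (gibbs μ g).map e = (gibbs μX a).prod (gibbs μY b) := by
  rw [gibbs, map_withDensity_of_measurePreserving e he, gibbs, gibbs,
    prod_withDensity (by fun_prop) (by fun_prop), integral_of_factor e he hg]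
  congr 1
  funext p
  rw [← ENNReal.ofReal_mul
    (mul_nonneg (inv_nonneg.2 (integral_nonneg ha)) (ha _))]
  simp only [Function.comp_apply, hg, e.apply_symm_apply, mul_inv]
  congr 1
  ring

end Gibbs

/-! ### Densities of conditionally independent families -/

section Density

variable {X₀ R₁ R₂ X Y₁ Y₂ : Type*} [MeasurableSpace X₀] [MeasurableSpace R₁] [MeasurableSpace R₂]
  [MeasurableSpace X] [MeasurableSpace Y₁] [MeasurableSpace Y₂]

/-- `K` is the conditional probability of `v ∈ F` given `u`. Integrated over any `E`, both sides
give the mass of `E ×ˢ F` under the law of `(u, v)`. -/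
theorem setLIntegral_fiber_ae_eq {μ : Measure X} [SigmaFinite μ] {ν : Measure Y₁} [SFinite ν]
    {ρ : Measure X₀} {η : Measure R₁} [SFinite η]
    {u : X₀ → X} (hu : Measurable u) {v : X₀ × R₁ → Y₁} (hv : Measurable v)
    {f : X → ENNReal} (hf : Measurable f) (hρ : ρ.map u = μ.withDensity f)
    {f₁ : X × Y₁ → ENNReal} (hf₁ : Measurable f₁)
    (h₁ : (ρ.prod η).map (fun p => (u p.1, v p)) = (μ.prod ν).withDensity f₁)
    {F : Set Y₁} (hF : MeasurableSet F) {K : X → ENNReal} (hK : Measurable K)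
    (hKu : ∀ x, K (u x) = η {r | v (x, r) ∈ F}) :
    (fun x => ∫⁻ y in F, f₁ (x, y) ∂ν) =ᵐ[μ] fun x => f x * K x := by
  refine ae_eq_of_forall_setLIntegral_eq_of_sigmaFinite hf₁.lintegral_prod_right' (hf.mul hK)
    fun E hE _ => ?_
  have huv : Measurable fun p : X₀ × R₁ => (u p.1, v p) := (hu.comp measurable_fst).prodMk hv
  have hpre : MeasurableSet ((fun p : X₀ × R₁ => (u p.1, v p)) ⁻¹' (E ×ˢ F)) :=
    huv (hE.prod hF)
  calc ∫⁻ x in E, ∫⁻ y in F, f₁ (x, y) ∂ν ∂μ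
      = ((μ.prod ν).withDensity f₁) (E ×ˢ F) := by
        rw [withDensity_apply _ (hE.prod hF), ← Measure.prod_restrict,
          lintegral_prod _ hf₁.aemeasurable]
    _ = ∫⁻ x in u ⁻¹' E, K (u x) ∂ρ := by
        rw [← h₁, Measure.map_apply huv (hE.prod hF), Measure.prod_apply hpre,
          ← lintegral_indicator (hu hE)]
        refine lintegral_congr fun x => ?_
        by_cases hx : x ∈ u ⁻¹' E
        · rw [Set.indicator_of_mem hx, hKu]
          congr 1
          ext r
          simp only [Set.mem_preimage, Set.mem_prod, Set.mem_ofPred_eq] at hx ⊢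
          tauto
        · rw [Set.indicator_of_notMem hx]
          convert measure_empty (μ := η)
          ext r
          simp only [Set.mem_preimage, Set.mem_prod, Set.mem_empty_iff_false] at hx ⊢
          tauto
    _ = ∫⁻ x in E, f x * K x ∂μ := by
        rw [← setLIntegral_map hE hK hu, hρ, setLIntegral_withDensity_eq_setLIntegral_mul _ hf hK hE]
        rfl

/-- Given the common coordinate, `v₁` and `v₂` depend on independent variables, so a box has mass `∫
f K₁ K₂ = ∫ (f K₁)(f K₂) / f`, and each `f Kᵢ` is a fibre integral of `fᵢ`. -/
theorem withDensity_glue {μ : Measure X} [SigmaFinite μ] {ν₁ : Measure Y₁} [SigmaFinite ν₁]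
    {ν₂ : Measure Y₂} [SigmaFinite ν₂] {ρ : Measure X₀} [IsFiniteMeasure ρ] {η₁ : Measure R₁}
    [IsFiniteMeasure η₁] {η₂ : Measure R₂} [IsFiniteMeasure η₂]
    {u : X₀ → X} (hu : MeasurableEmbedding u) {v₁ : X₀ × R₁ → Y₁} (hv₁ : Measurable v₁)
    {v₂ : X₀ × R₂ → Y₂} (hv₂ : Measurable v₂)
    {f : X → ENNReal} (hf : Measurable f) (hρ : ρ.map u = μ.withDensity f)
    {f₁ : X × Y₁ → ENNReal} (hf₁ : Measurable f₁)
    (h₁ : (ρ.prod η₁).map (fun p => (u p.1, v₁ p)) = (μ.prod ν₁).withDensity f₁)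
    {f₂ : X × Y₂ → ENNReal} (hf₂ : Measurable f₂)
    (h₂ : (ρ.prod η₂).map (fun p => (u p.1, v₂ p)) = (μ.prod ν₂).withDensity f₂) :
    (ρ.prod (η₁.prod η₂)).map
        (fun p => (u p.1, (v₁ (p.1, p.2.1), v₂ (p.1, p.2.2)))) =
      (μ.prod (ν₁.prod ν₂)).withDensity
        fun q => f₁ (q.1, q.2.1) * f₂ (q.1, q.2.2) / f q.1 := by
  have hm : Measurable fun p : X₀ × R₁ × R₂ => (u p.1, (v₁ (p.1, p.2.1), v₂ (p.1, p.2.2))) :=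
    (hu.measurable.comp measurable_fst).prodMk
      ((hv₁.comp (by fun_prop)).prodMk (hv₂.comp (by fun_prop)))
  have hftop : ∀ᵐ x ∂μ, f x ≠ ⊤ := by
    have : IsFiniteMeasure (ρ.map u) := inferInstance
    have hlt : ∫⁻ x, f x ∂μ ≠ ⊤ := by
      have := measure_ne_top (ρ.map u) Set.univ
      rwa [hρ, withDensity_apply _ MeasurableSet.univ, Measure.restrict_univ] at this
    filter_upwards [ae_lt_top hf hlt] with x hx using hx.ne
  refine Measure.ext_prod₃ fun {E F H} hE hF hH => ?_
  -- The conditional probabilities live on `X₀`; the embedding `u` carries them to measurable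
  -- functions on `X`.
  obtain ⟨K₁, hK₁, hK₁u⟩ := hu.exists_measurable_extend
    (measurable_measure_prodMk_left (ν := η₁) (hv₁ hF))
    fun _ => ⟨0⟩
  obtain ⟨K₂, hK₂, hK₂u⟩ := hu.exists_measurable_extend
    (measurable_measure_prodMk_left (ν := η₂) (hv₂ hH))
    fun _ => ⟨0⟩
  have e₁ := setLIntegral_fiber_ae_eq hu.measurable hv₁ hf hρ hf₁ h₁ hF hK₁
    fun x => congrFun hK₁u x
  have e₂ := setLIntegral_fiber_ae_eq hu.measurable hv₂ hf hρ hf₂ h₂ hH hK₂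
    fun x => congrFun hK₂u x
  have hEFH := hE.prod (hF.prod hH)
  have hden : Measurable fun q : X × Y₁ × Y₂ => f₁ (q.1, q.2.1) * f₂ (q.1, q.2.2) / f q.1 :=
    ((hf₁.comp (by fun_prop)).mul (hf₂.comp (by fun_prop))).div (hf.comp measurable_fst)
  have hpre := hm hEFH
  calc _ = ∫⁻ x in u ⁻¹' E, K₁ (u x) * K₂ (u x) ∂ρ := by
        rw [Measure.map_apply hm hEFH, Measure.prod_apply hpre,
          ← lintegral_indicator (hu.measurable hE)]
        refine lintegral_congr fun x => ?_
        by_cases hx : x ∈ u ⁻¹' E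
        · rw [Set.indicator_of_mem hx, show K₁ (u x) = _ from congrFun hK₁u x,
            show K₂ (u x) = _ from congrFun hK₂u x, ← Measure.prod_prod]
          congr 1
          ext r
          simp only [Set.mem_preimage, Set.mem_prod] at hx ⊢
          tauto
        · rw [Set.indicator_of_notMem hx]
          convert measure_empty (μ := η₁.prod η₂)
          ext r
          simp only [Set.mem_preimage, Set.mem_prod, Set.mem_empty_iff_false] at hx ⊢
          tauto
    _ = ∫⁻ x in E, f x * (K₁ x * K₂ x) ∂μ := by
        rw [← setLIntegral_map (f := fun x => K₁ x * K₂ x) hE (hK₁.mul hK₂) hu.measurable, hρ,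
          setLIntegral_withDensity_eq_setLIntegral_mul (g := fun x => K₁ x * K₂ x) _ hf
            (hK₁.mul hK₂) hE]
        rfl
    _ = ∫⁻ x in E, ((∫⁻ y in F, f₁ (x, y) ∂ν₁) * ∫⁻ z in H, f₂ (x, z) ∂ν₂) / f x ∂μ := by
        refine lintegral_congr_ae (ae_restrict_of_ae ?_)
        filter_upwards [e₁, e₂, hftop] with x h1 h2 h3
        rw [h1, h2]
        -- Where `f` vanishes so do both fibre integrals, and `0 / 0 = 0` is the right value.
        by_cases h0 : f x = 0
        · simp [h0]
        · rw [mul_mul_mul_comm, mul_assoc (f x), mul_div_assoc,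
            mul_div_assoc, mul_comm (f x) (_ / _), ENNReal.div_mul_cancel h0 h3]
    _ = _ := by
        rw [withDensity_apply _ hEFH, ← Measure.prod_restrict, ← Measure.prod_restrict,
          lintegral_prod _ hden.aemeasurable]
        refine lintegral_congr fun x => ?_
        simp only [div_eq_mul_inv]
        have m1 : Measurable fun y => f₁ (x, y) := hf₁.comp measurable_prodMk_left
        have m2 : Measurable fun y => f₂ (x, y) := hf₂.comp measurable_prodMk_left
        rw [lintegral_mul_const (f := fun y : Y₁ × Y₂ => f₁ (x, y.1) * f₂ (x, y.2)) _
            ((m1.comp measurable_fst).mul (m2.comp measurable_snd)),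
          lintegral_prod_mul m1.aemeasurable m2.aemeasurable]

end Density

/-! ### Coordinates adapted to a complete set of variables -/

section Coordinates

/-- Splitting the coordinates of `ℝ^γ` into two blocks. -/
def piSplit {κ₁ κ₂ κ : Type*} (e : κ₁ ⊕ κ₂ ≃ κ) : (κ → ℝ) ≃ᵐ (κ₁ → ℝ) × (κ₂ → ℝ) :=
  (MeasurableEquiv.piCongrLeft (fun _ => ℝ) e).symm.trans
    (MeasurableEquiv.sumPiEquivProdPi fun _ => ℝ)

theorem measurePreserving_piSplit {κ₁ κ₂ κ : Type*} [Fintype κ₁] [Fintype κ₂] [Fintype κ]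
    (e : κ₁ ⊕ κ₂ ≃ κ) :
    MeasurePreserving (piSplit e) volume ((volume : Measure (κ₁ → ℝ)).prod volume) :=
  ((volume_measurePreserving_piCongrLeft (fun _ => ℝ) e).symm _).trans
    (volume_measurePreserving_sumPiEquivProdPi fun _ => ℝ)

/-- The shear `(x, y) ↦ (x + f y, y)`. -/
def shear {X Y : Type*} [MeasurableSpace X] [MeasurableSpace Y] [AddGroup X] [MeasurableAdd₂ X]
    [MeasurableSub₂ X] (f : Y → X) (hf : Measurable f) : X × Y ≃ᵐ X × Y where
  toFun p := (p.1 + f p.2, p.2)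
  invFun p := (p.1 - f p.2, p.2)
  left_inv p := by simp
  right_inv p := by simp
  measurable_toFun := (measurable_fst.add (hf.comp measurable_snd)).prodMk measurable_snd
  measurable_invFun := (measurable_fst.sub (hf.comp measurable_snd)).prodMk measurable_snd

/-- On each fibre over `Y` the shear is a translation. -/
theorem measurePreserving_shear {X Y : Type*} [MeasurableSpace X] [MeasurableSpace Y]
    [AddGroup X] [MeasurableAdd₂ X] [MeasurableSub₂ X] {μ : Measure X} [SFinite μ]
    [μ.IsAddRightInvariant] {ν : Measure Y} [SFinite ν] (f : Y → X) (hf : Measurable f) :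
    MeasurePreserving (shear f hf) (μ.prod ν) (μ.prod ν) := by
  have h : MeasurePreserving (fun p : Y × X => (p.1, p.2 + f p.1)) (ν.prod μ) (ν.prod μ) :=
    (MeasurePreserving.id ν).skew_product (g := fun y x => x + f y)
      (measurable_snd.add (hf.comp measurable_fst))
      (Filter.Eventually.of_forall fun y => map_add_right_eq_self μ (f y))
  exact (Measure.measurePreserving_swap.comp h).comp Measure.measurePreserving_swap

variable {V : Type*} {I : V → Type*} [∀ v, Zero (I v)] {G : SimpleGraph V}
  [Fintype V] [DecidableEq V] [∀ v, Fintype (I v)] {A B S C : Finset V}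

theorem measurable_restShift (h : S ⊆ A) :
    Measurable (restShift h : (Rest I G A S → ℝ) → _) := by
  classical
  refine measurable_pi_iff.2 fun x => Finset.measurable_sum _ fun F _ =>
    (Real.measurable_log.comp ?_).const_mul _
  refine Finset.measurable_sum _ fun j _ => Real.measurable_exp.comp ?_
  refine Finset.measurable_sum _ fun y _ => ?_
  split_ifs
  · exact measurable_pi_apply y
  · exact measurable_const

theorem measurable_restTable (h : S ⊆ A) (i : Cell I S) :
    Measurable fun r : Rest I G A S → ℝ => restTable h r i := by
  classical
  refine Finset.measurable_sum _ fun j _ => Real.measurable_exp.comp ?_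
  refine Finset.measurable_sum _ fun y _ => ?_
  split_ifs
  · exact measurable_pi_apply y
  · exact measurable_const

theorem measurable_restKernel (h : S ⊆ A) (s : Param I G A → ℝ) (α : ℝ) :
    Measurable (restKernel h s α) := by
  have h1 := fun y => (measurable_pi_apply y).comp (measurable_restShift (I := I) (G := G) h)
  refine Real.measurable_exp.comp (((Finset.measurable_sum _ fun x _ => ?_).sub
    (Finset.measurable_sum _ fun y _ => (h1 y).mul_const _)).sub
    ((Real.measurable_log.comp (measurable_restTable h 0)).const_mul _))
  exact (measurable_pi_apply x).mul_const _

theorem priorKernel_pos (s : Param I G A → ℝ) (α : ℝ) (θ : Param I G A → ℝ) :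
    0 < priorKernel s α θ :=
  Real.exp_pos _

theorem measurable_priorKernel (s : Param I G A → ℝ) (α : ℝ) : Measurable (priorKernel s α) :=
  Real.measurable_exp.comp ((Finset.measurable_sum _ fun x _ =>
    (measurable_pi_apply x).mul_const _).sub ((Real.measurable_log.comp
      differentiable_partitionSum.continuous.measurable).const_mul _))

theorem isProbabilityMeasure_priorMeasure {s : Param I G A → ℝ} {α : ℝ} (hs : IsProper s α) :
    IsProbabilityMeasure (priorMeasure s α) :=
  isProbabilityMeasure_gibbs hs (priorKernel_pos s α)

theorem normConst_pos {s : Param I G A → ℝ} {α : ℝ} (hs : IsProper s α) : 0 < normConst s α :=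
  integral_pos_of_pos hs (priorKernel_pos s α)

/-- The coordinates on and outside `S`. -/
def splitCoord (h : S ⊆ A) : (Param I G A → ℝ) ≃ᵐ (Param I G S → ℝ) × (Rest I G A S → ℝ) :=
  piSplit (splitEquiv h)

theorem splitCoord_apply (h : S ⊆ A) (θ : Param I G A → ℝ) :
    splitCoord h θ = (restrictTo h θ, rest S θ) :=
  rfl

theorem measurePreserving_splitCoord (h : S ⊆ A) :
    MeasurePreserving (splitCoord h : (Param I G A → ℝ) ≃ᵐ _) volume (volume.prod volume) :=
  measurePreserving_piSplit _

/-- The coordinates `(θ^S, θ|_{S^c})`. -/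
def marginalCoord (h : S ⊆ A) :
    (Param I G A → ℝ) ≃ᵐ (Param I G S → ℝ) × (Rest I G A S → ℝ) :=
  (splitCoord h).trans (shear _ (measurable_restShift h))

theorem marginalCoord_apply (h : S ⊆ A) (hS : G.IsClique (S : Set V)) (θ : Param I G A → ℝ) :
    marginalCoord h θ = (marginalParam h θ, rest S θ) := by
  rw [marginalParam_eq h hS]
  rfl

theorem measurePreserving_marginalCoord (h : S ⊆ A) :
    MeasurePreserving (marginalCoord h : (Param I G A → ℝ) ≃ᵐ _) volume
      (volume.prod volume) :=
  (measurePreserving_splitCoord h).trans (measurePreserving_shear _ _)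

theorem priorKernel_factor (h : S ⊆ A) (hS : G.IsClique (S : Set V)) (s : Param I G A → ℝ)
    (α : ℝ) (θ : Param I G A → ℝ) :
    priorKernel s α θ = priorKernel (restrictTo h s) α (marginalCoord h θ).1 *
      restKernel h s α (marginalCoord h θ).2 := by
  rw [marginalCoord_apply h hS, priorKernel_eq h hS]

theorem isProper_iff (h : S ⊆ A) (hS : G.IsClique (S : Set V)) (s : Param I G A → ℝ) (α : ℝ) :
    IsProper s α ↔ IsProper (restrictTo h s) α ∧ Integrable (restKernel h s α) volume :=
  integrable_iff_of_factor _ (measurePreserving_marginalCoord h) (priorKernel_factor h hS s α)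
    (priorKernel_pos _ _) (restKernel_pos h s α)

theorem normConst_eq (h : S ⊆ A) (hS : G.IsClique (S : Set V)) (s : Param I G A → ℝ) (α : ℝ) :
    normConst s α = normConst (restrictTo h s) α * ∫ r, restKernel h s α r :=
  integral_of_factor _ (measurePreserving_marginalCoord h) (priorKernel_factor h hS s α)

theorem map_priorMeasure (h : S ⊆ A) (hS : G.IsClique (S : Set V)) (s : Param I G A → ℝ)
    (α : ℝ) :
    (priorMeasure s α).map (marginalCoord h) =
      (priorMeasure (restrictTo h s) α).prod (gibbs volume (restKernel h s α)) :=
  map_gibbs_of_factor _ (measurePreserving_marginalCoord h) (priorKernel_factor h hS s α)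
    (fun θ => (priorKernel_pos _ _ θ).le) (measurable_priorKernel _ _)
    (measurable_restKernel h s α)

/-! ### Coordinates adapted to a gluing -/

/-- The coordinates on `S`, on `A` outside `S`, and on `B` outside `S`. -/
def IsGluing.splitCoord (h : IsGluing G A B S C) : (Param I G C → ℝ) ≃ᵐ
    (Param I G S → ℝ) × (Rest I G A S → ℝ) × (Rest I G B S → ℝ) :=
  (ContingencyTable.splitCoord h.sep_subset).trans
    ((MeasurableEquiv.refl _).prodCongr (piSplit h.restEquiv))

theorem IsGluing.splitCoord_apply (h : IsGluing G A B S C) (θ : Param I G C → ℝ) :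
    h.splitCoord θ = (restrictTo h.sep_subset θ, rest S (restrictTo h.left_subset θ),
      rest S (restrictTo h.right_subset θ)) :=
  rfl

theorem IsGluing.measurePreserving_splitCoord (h : IsGluing G A B S C) :
    MeasurePreserving (h.splitCoord : (Param I G C → ℝ) ≃ᵐ _) volume
      (volume.prod (volume.prod volume)) :=
  (ContingencyTable.measurePreserving_splitCoord _).trans
    ((MeasurePreserving.id _).prod (measurePreserving_piSplit _))

/-- The coordinates `(θ^S, θ^A|_{A \ S}, θ^B|_{B \ S})`. -/
def IsGluing.marginalCoord (h : IsGluing G A B S C) : (Param I G C → ℝ) ≃ᵐ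
    (Param I G S → ℝ) × (Rest I G A S → ℝ) × (Rest I G B S → ℝ) :=
  (ContingencyTable.marginalCoord h.sep_subset).trans
    ((MeasurableEquiv.refl _).prodCongr (piSplit h.restEquiv))

theorem IsGluing.marginalCoord_apply (h : IsGluing G A B S C) (θ : Param I G C → ℝ) :
    h.marginalCoord θ = (marginalParam h.sep_subset θ,
      rest S (marginalParam h.left_subset θ), rest S (marginalParam h.right_subset θ)) := by
  rw [h.rest_marginalParam, h.symm.rest_marginalParam]
  rw [ContingencyTable.marginalParam_eq h.sep_subset h.complete]
  rfl

theorem IsGluing.measurePreserving_marginalCoord (h : IsGluing G A B S C) :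
    MeasurePreserving (h.marginalCoord : (Param I G C → ℝ) ≃ᵐ _) volume
      (volume.prod (volume.prod volume)) :=
  (ContingencyTable.measurePreserving_marginalCoord _).trans
    ((MeasurePreserving.id _).prod (measurePreserving_piSplit _))

theorem IsGluing.priorKernel_factor (h : IsGluing G A B S C) (s : Param I G C → ℝ) (α : ℝ)
    (θ : Param I G C → ℝ) :
    priorKernel s α θ =
      priorKernel (restrictTo h.sep_subset s) α (h.marginalCoord θ).1 *
      (fun r : (Rest I G A S → ℝ) × (Rest I G B S → ℝ) =>
        restKernel h.sep_left (restrictTo h.left_subset s) α r.1 *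
        restKernel h.sep_right (restrictTo h.right_subset s) α r.2) (h.marginalCoord θ).2 := by
  rw [h.marginalCoord_apply]
  exact h.priorKernel_eq s α θ

/-- The kernel is a product of three positive factors in `(θ^S, r_A, r_B)`, so each factor is
integrable; the factor on `S` recombines with either of the others. -/
theorem IsGluing.isProper (h : IsGluing G A B S C) {s : Param I G C → ℝ} {α : ℝ}
    (hs : IsProper s α) :
    IsProper (restrictTo h.left_subset s) α ∧ IsProper (restrictTo h.right_subset s) α ∧
      IsProper (restrictTo h.sep_subset s) α := by
  have h1 := (integrable_iff_of_factor _ h.measurePreserving_marginalCoord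
    (h.priorKernel_factor s α) (priorKernel_pos _ _) fun r =>
      mul_pos (restKernel_pos _ _ _ _) (restKernel_pos _ _ _ _)).1 hs
  have h2 := (integrable_iff_of_factor (MeasurableEquiv.refl _) (MeasurePreserving.id _)
    (fun _ => rfl) (restKernel_pos h.sep_left (restrictTo h.left_subset s) α)
    (restKernel_pos h.sep_right (restrictTo h.right_subset s) α)).1 h1.2
  exact ⟨(isProper_iff h.sep_left h.complete _ _).2 ⟨h1.1, h2.1⟩,
    (isProper_iff h.sep_right h.complete _ _).2 ⟨h1.1, h2.2⟩, h1.1⟩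

theorem IsGluing.normConst_eq (h : IsGluing G A B S C) (s : Param I G C → ℝ) (α : ℝ) :
    normConst s α = normConst (restrictTo h.sep_subset s) α *
      ((∫ r, restKernel h.sep_left (restrictTo h.left_subset s) α r) *
        ∫ r, restKernel h.sep_right (restrictTo h.right_subset s) α r) := by
  rw [← integral_of_factor (MeasurableEquiv.refl _) (MeasurePreserving.id _) fun _ => rfl]
  exact integral_of_factor _ h.measurePreserving_marginalCoord (h.priorKernel_factor s α)

theorem IsGluing.map_priorMeasure (h : IsGluing G A B S C) (s : Param I G C → ℝ) (α : ℝ) :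
    (priorMeasure s α).map h.marginalCoord =
      (priorMeasure (restrictTo h.sep_subset s) α).prod
        ((gibbs volume (restKernel h.sep_left (restrictTo h.left_subset s) α)).prod
          (gibbs volume (restKernel h.sep_right (restrictTo h.right_subset s) α))) := by
  have hA := measurable_restKernel h.sep_left (restrictTo h.left_subset s) α
  have hB := measurable_restKernel h.sep_right (restrictTo h.right_subset s) α
  rw [← map_gibbs_of_factor (MeasurableEquiv.refl _) (MeasurePreserving.id _) (fun _ => rfl)
    (fun r => (restKernel_pos _ _ _ r).le) hA hB]
  rw [show (⇑(MeasurableEquiv.refl ((Rest I G A S → ℝ) × (Rest I G B S → ℝ)))) = id from rfl,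
    Measure.map_id]
  exact map_gibbs_of_factor _ h.measurePreserving_marginalCoord (h.priorKernel_factor s α)
    (fun θ => (priorKernel_pos _ _ θ).le) (measurable_priorKernel _ _)
    ((hA.comp measurable_fst).mul (hB.comp measurable_snd))

/-- The conjugate prior is Markov with respect to a gluing. -/
theorem IsGluing.conjugatePrior_eq (h : IsGluing G A B S C) {s : Param I G C → ℝ} {α : ℝ}
    (hs : IsProper s α) (θ : Param I G C → ℝ) :
    conjugatePrior s α θ =
      conjugatePrior (restrictTo h.left_subset s) α (marginalParam h.left_subset θ) *
        conjugatePrior (restrictTo h.right_subset s) α (marginalParam h.right_subset θ) /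
        conjugatePrior (restrictTo h.sep_subset s) α (marginalParam h.sep_subset θ) := by
  obtain ⟨hA, hB, hS⟩ := h.isProper hs
  have eA := ContingencyTable.normConst_eq h.sep_left h.complete (restrictTo h.left_subset s) α
  have eB := ContingencyTable.normConst_eq h.sep_right h.complete (restrictTo h.right_subset s) α
  have pA := normConst_pos hA
  have pB := normConst_pos hB
  have pS := normConst_pos hS
  change _ = normConst (restrictTo h.sep_subset s) α * _ at eA
  change _ = normConst (restrictTo h.sep_subset s) α * _ at eB
  -- Nonvanishing of these integrals is what permits cancelling them in the ratio.
  have iA : (∫ r, restKernel h.sep_left (restrictTo h.left_subset s) α r) ≠ 0 := by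
    rintro h0; rw [h0, mul_zero] at eA; exact pA.ne' eA
  have iB : (∫ r, restKernel h.sep_right (restrictTo h.right_subset s) α r) ≠ 0 := by
    rintro h0; rw [h0, mul_zero] at eB; exact pB.ne' eB
  have pK := priorKernel_pos (restrictTo h.sep_subset s) α (marginalParam h.sep_subset θ)
  have kB := h.symm.priorKernel_left s α θ
  simp only [conjugatePrior, h.normConst_eq, eA, eB, h.priorKernel_eq, h.priorKernel_left]
  rw [kB]
  field_simp

end Coordinates

/-! ### The induced density along a gluing -/

section InducedDensity

variable {V : Type*} {I : V → Type*} [∀ v, Zero (I v)] {G : SimpleGraph V}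
  [Fintype V] [DecidableEq V] [∀ v, Fintype (I v)] {A B S C : Finset V}

theorem isFiniteMeasure_inducedPrior {s : Param I G A → ℝ} {α : ℝ} (hs : IsProper s α) :
    IsFiniteMeasure (inducedPrior s α) := by
  have := isProbabilityMeasure_priorMeasure hs
  unfold inducedPrior
  infer_instance

theorem measurable_inducedDensity (s : Param I G A → ℝ) (α : ℝ) :
    Measurable (inducedDensity s α) :=
  Measure.measurable_rnDeriv _ _

theorem inducedPrior_eq_withDensity {s : Param I G A → ℝ} {α : ℝ} (hs : IsProper s α) :
    inducedPrior s α = volume.withDensity (inducedDensity s α) := by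
  have := isFiniteMeasure_inducedPrior hs
  exact (Measure.withDensity_rnDeriv_eq _ _ (inducedPrior_absolutelyContinuous s α)).symm

/-- Lifts statements about almost every `m^B` to almost every `m`. -/
theorem quasiMeasurePreserving_restrictTo (h : B ⊆ A) :
    Measure.QuasiMeasurePreserving (restrictTo h : (Param I G A → ℝ) → _) volume volume :=
  Measure.quasiMeasurePreserving_fst.comp
    (measurePreserving_splitCoord h).quasiMeasurePreserving

theorem inducedDensity_restrictTo_ne_top (h : B ⊆ A) {s : Param I G B → ℝ} {α : ℝ}
    (hs : IsProper s α) :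
    ∀ᵐ m : Param I G A → ℝ, inducedDensity s α (restrictTo h m) ≠ ⊤ := by
  have := isFiniteMeasure_inducedPrior hs
  exact (quasiMeasurePreserving_restrictTo h).ae
    ((Measure.rnDeriv_lt_top (inducedPrior s α) volume).mono fun _ hx => hx.ne)

/-- The cell probabilities outside `S`, as a function of `(θ^S, θ|_{S^c})`. -/
def restCells (h : S ⊆ A) (p : (Param I G S → ℝ) × (Rest I G A S → ℝ)) : Rest I G A S → ℝ :=
  rest S (marginalCells ((marginalCoord h).symm p))

theorem measurable_restCells (h : S ⊆ A) :
    Measurable (restCells h : (Param I G S → ℝ) × (Rest I G A S → ℝ) → _) :=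
  (measurable_snd.comp (splitCoord h).measurable).comp
    (measurable_marginalCells.comp (marginalCoord h).symm.measurable)

/-- `m^S` depends on `θ^S` alone, which is independent of `r`; this is the form of input that
`withDensity_glue` requires. -/
theorem map_restCells (h : S ⊆ A) (hS : G.IsClique (S : Set V)) {s : Param I G A → ℝ} {α : ℝ}
    (hs : IsProper s α) :
    ((priorMeasure (restrictTo h s) α).prod (gibbs volume (restKernel h s α))).map
        (fun p => (marginalCells p.1, restCells h p)) =
      (volume.prod volume).withDensity (inducedDensity s α ∘ (splitCoord h).symm) := by
  have hm : Measurable fun p : (Param I G S → ℝ) × (Rest I G A S → ℝ) =>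
      (marginalCells p.1, restCells h p) :=
    (measurable_marginalCells.comp measurable_fst).prodMk (measurable_restCells h)
  rw [← map_withDensity_of_measurePreserving _ (measurePreserving_splitCoord h),
    ← inducedPrior_eq_withDensity hs, inducedPrior,
    Measure.map_map (splitCoord h).measurable measurable_marginalCells,
    ← map_priorMeasure h hS, Measure.map_map hm (marginalCoord h).measurable]
  congr 1
  funext θ
  simp only [Function.comp_apply, restCells, MeasurableEquiv.symm_apply_apply]
  rw [marginalCoord_apply h hS, splitCoord_apply, restrictTo_marginalCells_of_isClique h hS]

/-- The cell probabilities of the glued table, in the coordinates adapted to the gluing. -/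
def IsGluing.cells (h : IsGluing G A B S C)
    (p : (Param I G S → ℝ) × (Rest I G A S → ℝ) × (Rest I G B S → ℝ)) :
    (Param I G S → ℝ) × (Rest I G A S → ℝ) × (Rest I G B S → ℝ) :=
  (marginalCells p.1, (restCells h.sep_left (p.1, p.2.1), restCells h.sep_right (p.1, p.2.2)))

theorem IsGluing.measurable_cells (h : IsGluing G A B S C) :
    Measurable (h.cells (I := I)) :=
  (measurable_marginalCells.comp measurable_fst).prodMk
    (((measurable_restCells h.sep_left).comp (by fun_prop)).prodMk
      ((measurable_restCells h.sep_right).comp (by fun_prop)))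

theorem IsGluing.marginalCoord_symm_left (h : IsGluing G A B S C) (θ : Param I G C → ℝ) :
    (ContingencyTable.marginalCoord h.sep_left).symm
      (marginalParam h.sep_subset θ, rest S (marginalParam h.left_subset θ)) =
      marginalParam h.left_subset θ := by
  rw [MeasurableEquiv.symm_apply_eq, ContingencyTable.marginalCoord_apply _ h.complete,
    h.marginalParam_marginalParam]

/-- `θ^A` is determined by `(θ^S, r_A)` and `θ^B` by `(θ^S, r_B)`, so each block of `m` ignores the
opposite side. -/
theorem IsGluing.cells_marginalCoord (h : IsGluing G A B S C) (θ : Param I G C → ℝ) :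
    h.cells (h.marginalCoord θ) = h.splitCoord (marginalCells θ) := by
  rw [IsGluing.cells, h.marginalCoord_apply, h.splitCoord_apply, restCells, restCells,
    h.marginalCoord_symm_left, h.symm.marginalCoord_symm_left,
    restrictTo_marginalCells_of_isClique h.sep_subset h.complete,
    h.restrictTo_marginalCells, h.symm.restrictTo_marginalCells]

theorem IsGluing.map_splitCoord_inducedPrior (h : IsGluing G A B S C) (s : Param I G C → ℝ)
    (α : ℝ) :
    (inducedPrior s α).map h.splitCoord =
      ((priorMeasure (restrictTo h.sep_subset s) α).prod
        ((gibbs volume (restKernel h.sep_left (restrictTo h.left_subset s) α)).prod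
          (gibbs volume (restKernel h.sep_right (restrictTo h.right_subset s) α)))).map
        h.cells := by
  have hcomp : h.splitCoord ∘ marginalCells = h.cells (I := I) ∘ h.marginalCoord :=
    funext fun θ => (h.cells_marginalCoord θ).symm
  rw [inducedPrior, Measure.map_map h.splitCoord.measurable measurable_marginalCells, hcomp,
    ← Measure.map_map h.measurable_cells h.marginalCoord.measurable, h.map_priorMeasure]

theorem IsGluing.splitCoord_symm_left (h : IsGluing G A B S C) (m : Param I G C → ℝ) :
    (ContingencyTable.splitCoord h.sep_left).symm
        ((h.splitCoord m).1, (h.splitCoord m).2.1) = restrictTo h.left_subset m := by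
  rw [MeasurableEquiv.symm_apply_eq]; rfl

theorem IsGluing.splitCoord_symm_right (h : IsGluing G A B S C) (m : Param I G C → ℝ) :
    (ContingencyTable.splitCoord h.sep_right).symm
        ((h.splitCoord m).1, (h.splitCoord m).2.2) = restrictTo h.right_subset m := by
  rw [MeasurableEquiv.symm_apply_eq]; rfl

theorem IsGluing.inducedDensity_ae_eq (h : IsGluing G A B S C) {s : Param I G C → ℝ} {α : ℝ}
    (hs : IsProper s α) :
    inducedDensity s α =ᵐ[volume] fun m =>
      inducedDensity (restrictTo h.left_subset s) α (restrictTo h.left_subset m) *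
        inducedDensity (restrictTo h.right_subset s) α (restrictTo h.right_subset m) /
        inducedDensity (restrictTo h.sep_subset s) α (restrictTo h.sep_subset m) := by
  obtain ⟨hA, hB, hS⟩ := h.isProper hs
  have pS := isProbabilityMeasure_priorMeasure hS
  have iA := ((isProper_iff h.sep_left h.complete _ _).1 hA).2
  have iB := ((isProper_iff h.sep_right h.complete _ _).1 hB).2
  have pA := isProbabilityMeasure_gibbs iA (restKernel_pos _ _ _)
  have pB := isProbabilityMeasure_gibbs iB (restKernel_pos _ _ _)
  have mA := measurable_inducedDensity (restrictTo h.left_subset s) α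
  have mB := measurable_inducedDensity (restrictTo h.right_subset s) α
  have mS := measurable_inducedDensity (restrictTo h.sep_subset s) α
  have gA := map_restCells h.sep_left h.complete hA
  have gB := map_restCells h.sep_right h.complete hB
  rw [show restrictTo h.sep_left (restrictTo h.left_subset s) = restrictTo h.sep_subset s
    from rfl] at gA
  rw [show restrictTo h.sep_right (restrictTo h.right_subset s) = restrictTo h.sep_subset s
    from rfl] at gB
  -- The common variable is `θ^S`, and the parameters outside `S` on the two sides are the
  -- independent ones.
  have key := withDensity_glue measurableEmbedding_marginalCells
    (measurable_restCells h.sep_left) (measurable_restCells h.sep_right) mS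
    (inducedPrior_eq_withDensity hS)
    (mA.comp (ContingencyTable.splitCoord h.sep_left).symm.measurable) gA
    (mB.comp (ContingencyTable.splitCoord h.sep_right).symm.measurable) gB
  have hmain : (inducedPrior s α).map h.splitCoord = (volume.withDensity fun m =>
      inducedDensity (restrictTo h.left_subset s) α (restrictTo h.left_subset m) *
        inducedDensity (restrictTo h.right_subset s) α (restrictTo h.right_subset m) /
        inducedDensity (restrictTo h.sep_subset s) α
          (restrictTo h.sep_subset m)).map h.splitCoord := by
    rw [h.map_splitCoord_inducedPrior,
      map_withDensity_of_measurePreserving _ h.measurePreserving_splitCoord]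
    refine key.trans (congrArg _ (funext fun q => ?_))
    obtain ⟨m, rfl⟩ := h.splitCoord.surjective q
    simp only [Function.comp_apply, MeasurableEquiv.symm_apply_apply, h.splitCoord_symm_left,
      h.splitCoord_symm_right]
    rfl
  have hpi := h.splitCoord.map_measurableEquiv_injective hmain
  rw [inducedDensity, hpi]
  exact Measure.rnDeriv_withDensity _
    (((mA.comp (quasiMeasurePreserving_restrictTo _).measurable).mul
      (mB.comp (quasiMeasurePreserving_restrictTo _).measurable)).div
      (mS.comp (quasiMeasurePreserving_restrictTo _).measurable))

end InducedDensity

/-! ### Chains of gluings -/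

section Chain

variable {V : Type*} [DecidableEq V]

/-- `A` arises from `P 0` by successively gluing `P 1, P 2, …` along complete sets
`S 0, S 1, …`. -/
def IsGluingChain (G : SimpleGraph V) : (k : ℕ) → (P : Fin (k + 1) → Finset V) →
    (S : Fin k → Finset V) → Finset V → Prop
  | 0, P, _, A => A = P 0
  | k + 1, P, S, A => ∃ A', IsGluingChain G k (fun l => P l.castSucc) (fun l => S l.castSucc) A' ∧
      IsGluing G A' (P (Fin.last _)) (S (Fin.last _)) A

/-- The second hypothesis, that a complete set covered by an initial segment lies in one of its
members, survives truncation of the list; this makes the induction run. -/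
theorem isGluingChain_of_cover {G : SimpleGraph V} : ∀ {k : ℕ} (P : Fin (k + 1) → Finset V),
    (∀ l, l ≠ 0 → G.IsClique (separator P l : Set V)) →
    (∀ n (D : Finset V), G.IsClique (D : Set V) →
      (∀ v ∈ D, ∃ j ≤ n, v ∈ P j) → ∃ q ≤ n, D ⊆ P q) →
    IsGluingChain G k P (fun l => separator P l.succ) (Finset.univ.biUnion P)
  | 0, P, _, _ => by simp [IsGluingChain]
  | k + 1, P, hcl, hcov => by
    -- A separator involves only earlier sets, so dropping the last set does not change it.
    have hsep : ∀ l : Fin (k + 1),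
        separator (fun l : Fin (k + 1) => P l.castSucc) l = separator P l.castSucc := by
      intro l
      ext v
      simp only [separator, Finset.mem_inter, Finset.mem_biUnion, Finset.mem_filter,
        Finset.mem_univ, true_and]
      refine and_congr_right fun _ => ⟨?_, ?_⟩
      · rintro ⟨j, hj, hv⟩
        exact ⟨j.castSucc, Fin.castSucc_lt_castSucc_iff.2 hj, hv⟩
      · rintro ⟨j, hj, hv⟩
        obtain ⟨i, rfl⟩ := Fin.exists_castSucc_eq.2 (hj.trans_le (Fin.le_last _)).ne
        exact ⟨i, Fin.castSucc_lt_castSucc_iff.1 hj, hv⟩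
    refine ⟨Finset.univ.biUnion fun l : Fin (k + 1) => P l.castSucc, ?_, ?_⟩
    · have ih := isGluingChain_of_cover (G := G) (fun l : Fin (k + 1) => P l.castSucc)
        (fun l hl => by
          rw [hsep]
          exact hcl _ fun h => hl (Fin.castSucc_injective _ h))
        (fun n D hD hv => by
          obtain ⟨q, hq, hDq⟩ := hcov n.castSucc D hD fun v hvD => by
            obtain ⟨j, hj, hvj⟩ := hv v hvD
            exact ⟨j.castSucc, Fin.castSucc_le_castSucc_iff.2 hj, hvj⟩
          obtain ⟨i, rfl⟩ := Fin.exists_castSucc_eq.2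
            (hq.trans_lt (Fin.castSucc_lt_last n)).ne
          exact ⟨i, Fin.castSucc_le_castSucc_iff.1 hq, hDq⟩)
      simp only [hsep] at ih
      exact ih
    · have hmem : ∀ v, v ∈ separator P (Fin.last k).succ ↔
          v ∈ P (Fin.last (k + 1)) ∧ ∃ j : Fin (k + 1), v ∈ P j.castSucc := by
        intro v
        simp only [separator, Finset.mem_inter, Finset.mem_biUnion, Finset.mem_filter,
          Finset.mem_univ, true_and, Fin.succ_last]
        refine and_congr_right fun _ => ⟨?_, ?_⟩
        · rintro ⟨j, hj, hv⟩
          obtain ⟨i, rfl⟩ := Fin.exists_castSucc_eq.2 hj.ne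
          exact ⟨i, hv⟩
        · rintro ⟨j, hv⟩
          exact ⟨j.castSucc, Fin.castSucc_lt_last j, hv⟩
      have hlast : ∀ j : Fin (k + 2), j = Fin.last _ ∨ ∃ i : Fin (k + 1), i.castSucc = j :=
        fun j => or_iff_not_imp_left.2 fun hj => Fin.exists_castSucc_eq.2 hj
      refine
        { left_subset := fun v hv => ?_
          right_subset := Finset.subset_biUnion_of_mem P (Finset.mem_univ _)
          sep_left := fun v hv => ?_
          sep_right := fun v hv => ((hmem v).1 hv).1
          subset_union := fun v hv => ?_
          inter_subset := fun v hv => ?_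
          complete := hcl _ (Fin.succ_ne_zero _)
          cover := fun D hD hc => ?_ }
      · simp only [Finset.mem_biUnion, Finset.mem_univ, true_and] at hv ⊢
        exact ⟨_, hv.choose_spec⟩
      · simpa using ((hmem v).1 hv).2
      · simp only [Finset.mem_union, Finset.mem_biUnion, Finset.mem_univ, true_and] at hv ⊢
        obtain ⟨j, hj⟩ := hv
        rcases hlast j with rfl | ⟨i, rfl⟩
        · exact Or.inr hj
        · exact Or.inl ⟨i, hj⟩
      · rw [Finset.mem_inter, Finset.mem_biUnion] at hv
        obtain ⟨⟨j, _, hj⟩, hv⟩ := hv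
        exact (hmem v).2 ⟨hv, j, hj⟩
      · obtain ⟨q, _, hq⟩ := hcov (Fin.last _) D hc fun v hv => by
          obtain ⟨j, _, hj⟩ := Finset.mem_biUnion.1 (hD hv)
          exact ⟨j, Fin.le_last _, hj⟩
        rcases hlast q with rfl | ⟨i, rfl⟩
        · exact Or.inr hq
        · exact Or.inl (hq.trans (Finset.subset_biUnion_of_mem
            (fun l : Fin (k + 1) => P l.castSucc) (Finset.mem_univ i)))

/-! ### Complete sets in a perfect enumeration of prime components. -/

theorem isPrimeSet_of_isClique {G : SimpleGraph V} {D : Finset V}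
    (hD : G.IsClique (D : Set V)) : IsPrimeSet G D := by
  rintro ⟨A, B, C, h⟩
  obtain ⟨a, ha⟩ := h.nonempty_left
  obtain ⟨b, hb⟩ := h.nonempty_right
  have haD : a ∈ D := h.union_eq ▸ Finset.mem_union_left _ (Finset.mem_union_left _ ha)
  have hbD : b ∈ D := h.union_eq ▸ Finset.mem_union_left _ (Finset.mem_union_right _ hb)
  exact h.separates a ha b hb (hD haD hbD (Finset.disjoint_left.1 h.disjoint_AB ha <| · ▸ hb))

/-- A complete set is prime, and by finiteness it lies in a maximal prime set. -/
theorem IsPerfectEnumeration.exists_subset [Finite V] {G : SimpleGraph V} {k : ℕ}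
    {P : Fin (k + 1) → Finset V} (hP : IsPerfectEnumeration G P) {D : Finset V}
    (hD : G.IsClique (D : Set V)) : ∃ l, D ⊆ P l := by
  obtain ⟨W, hDW, hW⟩ := (Set.toFinite {W : Finset V | IsPrimeSet G W}).exists_le_maximal
    (isPrimeSet_of_isClique hD)
  obtain ⟨l, rfl⟩ := (hP.mem_iff W).1 hW
  exact ⟨l, hDW⟩

/-- If `D ⊆ P l` with `l > n`, each vertex of `D` also occurs earlier, so `D` lies in the separator
of `l` and hence in some `P q` with `q < l`; descent ends at an index at most `n`. -/
theorem IsPerfectEnumeration.exists_subset_le [Finite V] {G : SimpleGraph V} {k : ℕ}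
    {P : Fin (k + 1) → Finset V} (hP : IsPerfectEnumeration G P) (n : Fin (k + 1)) {D : Finset V}
    (hD : G.IsClique (D : Set V)) (hn : ∀ v ∈ D, ∃ j ≤ n, v ∈ P j) : ∃ q ≤ n, D ⊆ P q := by
  obtain ⟨l, hl⟩ := hP.exists_subset hD
  induction l using WellFoundedLT.induction with
  | ind l ih =>
    by_cases hln : l ≤ n
    · exact ⟨l, hln, hl⟩
    · rw [not_le] at hln
      obtain ⟨q, hq, hsub⟩ := hP.running_intersection l ((Fin.zero_le n).trans_lt hln).ne'
      refine ih q hq fun v hv => hsub ?_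
      obtain ⟨j, hj, hvj⟩ := hn v hv
      rw [separator, Finset.mem_inter, Finset.mem_biUnion]
      exact ⟨hl hv, j, Finset.mem_filter.2 ⟨Finset.mem_univ _, hj.trans_lt hln⟩, hvj⟩

theorem IsPerfectEnumeration.isGluingChain [Fintype V] {G : SimpleGraph V} {k : ℕ}
    {P : Fin (k + 1) → Finset V} (hP : IsPerfectEnumeration G P) :
    IsGluingChain G k P (fun l => separator P l.succ) Finset.univ := by
  -- Singletons are complete, so the components cover all vertices.
  have h : Finset.univ.biUnion P = Finset.univ := by
    refine Finset.eq_univ_of_forall fun v => ?_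
    obtain ⟨l, hl⟩ := hP.exists_subset (D := {v}) (by simp)
    exact Finset.mem_biUnion.2 ⟨l, Finset.mem_univ _, hl (Finset.mem_singleton_self v)⟩
  rw [← h]
  exact isGluingChain_of_cover P hP.complete fun n D hD hn => hP.exists_subset_le n hD hn

/-! ### The Markov ratios along a chain. -/

variable {I : V → Type*} [∀ v, Zero (I v)] [Fintype V] [∀ v, Fintype (I v)]

theorem marginalParam_refl {G : SimpleGraph V} {A : Finset V} (h : A ⊆ A) (θ : Param I G A → ℝ) :
    marginalParam h θ = θ := by
  rw [marginalParam, marginal_refl, logLinear_cellProb]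

theorem IsGluingChain.markov {G : SimpleGraph V} : ∀ {k : ℕ} {P : Fin (k + 1) → Finset V}
    {S : Fin k → Finset V} {A : Finset V}, IsGluingChain G k P S A →
    ∀ (hP : ∀ l, P l ⊆ A) (hS : ∀ l, S l ⊆ A) {s : Param I G A → ℝ} {α : ℝ}, IsProper s α →
    (∀ l, IsProper (restrictTo (hP l) s) α) ∧
    (∀ l, IsProper (restrictTo (hS l) s) α) ∧
    (∀ θ : Param I G A → ℝ, conjugatePrior s α θ =
      (∏ l, conjugatePrior (restrictTo (hP l) s) α (marginalParam (hP l) θ)) /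
        ∏ l, conjugatePrior (restrictTo (hS l) s) α (marginalParam (hS l) θ)) ∧
    (∀ᵐ m : Param I G A → ℝ, inducedDensity s α m =
      (∏ l, inducedDensity (restrictTo (hP l) s) α (restrictTo (hP l) m)) /
        ∏ l, inducedDensity (restrictTo (hS l) s) α (restrictTo (hS l) m))
  | 0, P, S, A, h, hP, hS, s, α, hs => by
    obtain rfl : A = P 0 := h
    refine ⟨fun l => ?_, fun l => l.elim0, fun θ => ?_, Filter.Eventually.of_forall fun m => ?_⟩
    · obtain rfl : l = 0 := Fin.fin_one_eq_zero l
      exact hs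
    · simp only [Fin.prod_univ_succ, Fin.prod_univ_zero, div_one, mul_one, marginalParam_refl]
      rfl
    · simp only [Fin.prod_univ_succ, Fin.prod_univ_zero, div_one, mul_one]
      rfl
  | k + 1, P, S, A, h, hP, hS, s, α, hs => by
    obtain ⟨A', hchain, hg⟩ := h
    obtain ⟨pA, pB, pS⟩ := hg.isProper hs
    -- The induction hypothesis needs the inclusions into `A'`, not merely into `A`.
    have hsub : ∀ {k : ℕ} {P : Fin (k + 1) → Finset V} {S : Fin k → Finset V} {A : Finset V},
        IsGluingChain G k P S A → (∀ l, P l ⊆ A) ∧ ∀ l, S l ⊆ A := by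
      intro k
      induction k with
      | zero =>
        intro P S A h
        obtain rfl : A = P 0 := h
        exact ⟨fun l => (Fin.fin_one_eq_zero l) ▸ subset_rfl, fun l => l.elim0⟩
      | succ k ih =>
        rintro P S A ⟨A', h, hg⟩
        obtain ⟨h1, h2⟩ := ih h
        exact ⟨Fin.lastCases hg.right_subset fun l => (h1 l).trans hg.left_subset,
          Fin.lastCases hg.sep_subset fun l => (h2 l).trans hg.left_subset⟩
    obtain ⟨hP', hS'⟩ := hsub hchain
    obtain ⟨i1, i2, i3, i4⟩ := hchain.markov hP' hS' pA
    refine ⟨Fin.lastCases pB i1, Fin.lastCases pS i2, fun θ => ?_, ?_⟩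
    · rw [hg.conjugatePrior_eq hs, i3, div_mul_eq_mul_div, div_div]
      simp only [hg.marginalParam_marginalParam]
      exact congrArg₂ (· / ·)
        (Fin.prod_univ_castSucc fun l =>
          conjugatePrior (restrictTo (hP l) s) α (marginalParam (hP l) θ)).symm
        (Fin.prod_univ_castSucc fun l =>
          conjugatePrior (restrictTo (hS l) s) α (marginalParam (hS l) θ)).symm
    -- Finiteness of the separator densities is needed to merge the two denominators.
    · have t1 : ∀ᵐ m : Param I G A → ℝ, ∀ l : Fin k,
          inducedDensity (restrictTo (hS' l) (restrictTo hg.left_subset s)) α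
            (restrictTo ((hS' l).trans hg.left_subset) m) ≠ ⊤ :=
        ae_all_iff.2 fun l => inducedDensity_restrictTo_ne_top _ (i2 l)
      filter_upwards [hg.inducedDensity_ae_eq hs,
        (quasiMeasurePreserving_restrictTo hg.left_subset).ae i4, t1,
        inducedDensity_restrictTo_ne_top hg.sep_subset pS] with m e1 e2 e3 e4
      have hne : (∏ l, inducedDensity (restrictTo (hS' l) (restrictTo hg.left_subset s)) α
            (restrictTo (hS' l) (restrictTo hg.left_subset m))) ≠ ⊤ :=
        ENNReal.prod_ne_top fun l _ => e3 l
      rw [e1, e2]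
      -- The inverse of `b * d` splits unless the product is `0 * ⊤`, which finiteness excludes.
      have harith : ∀ a b c d : ENNReal, b ≠ ⊤ → d ≠ ⊤ → a / b * c / d = a * c / (b * d) := by
        intro a b c d hb hd
        rw [div_eq_mul_inv, div_eq_mul_inv, div_eq_mul_inv,
          ENNReal.mul_inv (Or.inr hd) (Or.inl hb), mul_right_comm a, mul_assoc]
      rw [harith _ _ _ _ hne e4]
      exact congrArg₂ (· / ·)
        (Fin.prod_univ_castSucc fun l =>
          inducedDensity (restrictTo (hP l) s) α (restrictTo (hP l) m)).symm
        (Fin.prod_univ_castSucc fun l =>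
          inducedDensity (restrictTo (hS l) s) α (restrictTo (hS l) m)).symm

end Chain

end ContingencyTable

end

theorem proposition5p1 {V : Type*} [Fintype V] [DecidableEq V]
    {I : V → Type*} [∀ v, Fintype (I v)] [∀ v, Zero (I v)]
    (G : SimpleGraph V) {k : ℕ} (P : Fin (k + 1) → Finset V)
    (hP : IsPerfectEnumeration G P)
    (s : Param I G Finset.univ → ℝ) (α : ℝ) (hs : IsProper s α) :
    -- the priors on the components and on the separators are proper
    (∀ l, IsProper (restrictTo (P l).subset_univ s) α) ∧
    (∀ l : Fin k, IsProper (restrictTo (separator P l.succ).subset_univ s) α) ∧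
    -- the Markov ratio for the density of the log-linear parameter
    (∀ θ : Param I G Finset.univ → ℝ,
      conjugatePrior s α θ =
        (∏ l, conjugatePrior (restrictTo (P l).subset_univ s) α
            (marginalParam (P l).subset_univ θ)) /
          ∏ l : Fin k, conjugatePrior (restrictTo (separator P l.succ).subset_univ s) α
            (marginalParam (separator P l.succ).subset_univ θ)) ∧
    -- the induced priors on the cell probabilities have Lebesgue densities
    inducedPrior s α ≪ MeasureTheory.volume ∧
    (∀ l, inducedPrior (restrictTo (P l).subset_univ s) α ≪ MeasureTheory.volume) ∧
    (∀ l : Fin k, inducedPrior (restrictTo (separator P l.succ).subset_univ s) α ≪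
      MeasureTheory.volume) ∧
    -- the Markov ratio for these densities
    (∀ᵐ m : Param I G Finset.univ → ℝ,
      inducedDensity s α m =
        (∏ l, inducedDensity (restrictTo (P l).subset_univ s) α
            (restrictTo (P l).subset_univ m)) /
          ∏ l : Fin k, inducedDensity (restrictTo (separator P l.succ).subset_univ s) α
            (restrictTo (separator P l.succ).subset_univ m)) := by
  obtain ⟨h1, h2, h3, h4⟩ := hP.isGluingChain.markov (fun l => (P l).subset_univ)
    (fun l => (separator P l.succ).subset_univ) hs
  exact ⟨h1, h2, h3, inducedPrior_absolutelyContinuous _ _,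
    fun _ => inducedPrior_absolutelyContinuous _ _,
    fun _ => inducedPrior_absolutelyContinuous _ _, h4⟩
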